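/- A composition is a finite sequence $\mathbf k=(k_1,\dots,k_r)$, $r\ge 1$, of positive integers; put $|\mathbf k|=k_1+\cdots+k_r$, $\operatorname{dep}(\mathbf k)=r$, $\overleftarrow{\mathbf k}=(k_r,\dots,k_1)$ and $\mathbf k_+=(k_1+1,k_2,\dots,k_r)$. The Hoffman dual $\mathbf k^\vee=(k_1',\dots,k_{r'}')$ is the unique composition with $|\mathbf k^\vee|=|\mathbf k|$ such that $\{1,\dots,|\mathbf k|-1\}$ is the disjoint union of $\{k_1+\cdots+k_i:1\le i\le r-1\}$ and $\{k'_1+\cdots+k'_i:1\le i\le r'-1\}$. For $\mathbf j=(j_1,\dots,j_r)\in\mathbb N_0^r$ put $|\mathbf j|=j_1+\cdots+j_r$, $\operatorname{dep}(\mathbf j)=r$, $\mathbf k+\mathbf j=(k_1+j_1,\dots,k_r+j_r)$ and $B(\mathbf k;\mathbf j)=\prod_{i=1}^r\binom{k_i+j_i-1}{j_i}$. For $k_1>1$ let $$\zeta(\mathbf k)=\sum_{n_1>\cdots>n_r>0}\frac1{n_1^{k_1}\cdots n_r^{k_r}},\qquad T(\mathbf k)=\sum_{\substack{n_1>\cdots>n_r>0\\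 n_i\equiv r+1-i\ (2)}}\frac{2^r}{n_1^{k_1}\cdots n_r^{k_r}},$$ and for any composition $\mathbf k$ and $0\le x<1$ let $$\mathrm{Li}_{\mathbf k}(x)=\sum_{n_1>\cdots>n_r>0}\frac{x^{n_1}}{n_1^{k_1}\cdots n_r^{k_r}},\qquad \mathrm A(\mathbf k;x)=2^r\sum_{\substack{n_1>\cdots>n_r>0\\ n_i\equiv r+1-i\ (2)}}\frac{x^{n_1}}{n_1^{k_1}\cdots n_r^{k_r}}.$$ For $\Re(s)>0$ the Arakawa--Kaneko zeta function and the Kaneko--Tsumura $\psi$-function are $$\xi(s;\mathbf k)=\frac1{\Gamma(s)}\int_0^\infty\frac{t^{s-1}}{e^t-1}\,\mathrm{Li}_{\mathbf k}(1-e^{-t})\,dt,\qquad \psi(s;\mathbf k)=\frac1{\Gamma(s)}\int_0^\infty t^{s-1}\,\frac{\mathrm A(\mathbf k;\tanh(t/2))}{\sinh t}\,dt.$$ Then for every composition $\mathbf k$ and every $k\in\mathbb N_0$, with $n:=|\mathbf k|+1-\operatorname{dep}(\mathbf k)$ (the depth of $(\overleftarrow{\mathbf k}^\vee)_+$), $$\xi(k+1;\mathbf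 k)=\sum_{\substack{\mathbf j\in\mathbb N_0^n\\ |\mathbf j|=k}}B\big((\overleftarrow{\mathbf k}^\vee)_+;\mathbf j\big)\,\zeta\big((\overleftarrow{\mathbf k}^\vee)_++\mathbf j\big),$$ $$\psi(k+1;\mathbf k)=\sum_{\substack{\mathbf j\in\mathbb N_0^n\\ |\mathbf j|=k}}B\big((\overleftarrow{\mathbf k}^\vee)_+;\mathbf j\big)\,T\big((\overleftarrow{\mathbf k}^\vee)_++\mathbf j\big),$$ where all the series (those for $\mathrm{Li}_{\mathbf k}(x)$ and $\mathrm A(\mathbf k;x)$ at every $0<x<1$) and integrals involved converge absolutely. -/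

import Mathlib

open scoped BigOperators

noncomputable section

namespace ArakawaKaneko

/-! ## Compositions -/

/-- A composition `(k₁, …, k_r)`, `r ≥ 1`, of positive integers, as a list.  Its weight is
`k.sum` and its depth is `k.length`; its reversal is `k.reverse`. -/
def IsComposition (k : List ℕ) : Prop := k ≠ [] ∧ ∀ a ∈ k, 0 < a

/-- `k₊ = (k₁ + 1, k₂, …, k_r)`; by convention the missing first entry of the empty list is `0`. -/
def plus : List ℕ → List ℕ
  | [] => [1]
  | a :: l => (a + 1) :: l

/-- The Hoffman dual, by exchanging commas and plus signs in
`(1 + ⋯ + 1, …, 1 + ⋯ + 1)`: the first entry `k₁` turns into `k₁` ones separated by commas, the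
last of which is added to the first entry of what the remaining entries turn into. -/
def hoffmanDual : List ℕ → List ℕ
  | [] => []
  | a :: l => List.replicate (a - 1) 1 ++ plus (hoffmanDual l)

/-- The set of proper partial sums `k₁ + ⋯ + k_j`, `1 ≤ j ≤ r - 1`. -/
def partialSums (k : List ℕ) : Set ℕ := {s | ∃ j, 1 ≤ j ∧ j < k.length ∧ s = (k.take j).sum}

/-- The characterization of the Hoffman dual by partial sums. -/
def IsHoffmanDual (k k' : List ℕ) : Prop :=
  IsComposition k' ∧ k'.sum = k.sum ∧
    Disjoint (partialSums k) (partialSums k') ∧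
    partialSums k ∪ partialSums k' = Set.Icc 1 (k.sum - 1)

theorem partialSums_singleton (a : ℕ) : partialSums [a] = ∅ := by
  ext s
  simp only [partialSums, Set.mem_ofPred_eq, List.length_singleton, Set.mem_empty_iff_false,
    iff_false]
  rintro ⟨j, h1, h2, -⟩
  omega

theorem mem_partialSums_cons (a : ℕ) (l : List ℕ) (hl : l ≠ []) (s : ℕ) :
    s ∈ partialSums (a :: l) ↔ s = a ∨ ∃ t ∈ partialSums l, s = a + t := by
  have hl' : 0 < l.length := List.length_pos_iff.2 hl
  simp only [partialSums, Set.mem_ofPred_eq, List.length_cons]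
  constructor
  · rintro ⟨j, h1, h2, rfl⟩
    obtain ⟨i, rfl⟩ : ∃ i, j = i + 1 := ⟨j - 1, by omega⟩
    rcases Nat.eq_zero_or_pos i with rfl | hi
    · left; simp
    · right; exact ⟨_, ⟨i, hi, by omega, rfl⟩, by simp⟩
  · rintro (rfl | ⟨t, ⟨j, h1, h2, rfl⟩, rfl⟩)
    · exact ⟨1, le_rfl, by omega, by simp⟩
    · exact ⟨j + 1, by omega, by omega, by simp⟩

theorem plus_ne_nil (l : List ℕ) : plus l ≠ [] := by cases l <;> simp [plus]

theorem sum_plus (l : List ℕ) : (plus l).sum = l.sum + 1 := by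
  cases l
  · simp [plus]
  · simp [plus]; omega

theorem mem_partialSums_plus (l : List ℕ) (s : ℕ) :
    s ∈ partialSums (plus l) ↔ ∃ t ∈ partialSums l, s = t + 1 := by
  rcases l with _ | ⟨a, l⟩
  · simp [plus, partialSums]
  · rcases eq_or_ne l [] with rfl | hl
    · simp [plus, partialSums_singleton]
    · simp only [plus, mem_partialSums_cons _ _ hl]
      constructor
      · rintro (rfl | ⟨t, ht, rfl⟩)
        · exact ⟨a, Or.inl rfl, rfl⟩
        · exact ⟨a + t, Or.inr ⟨t, ht, rfl⟩, by omega⟩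
      · rintro ⟨t, rfl | ⟨t, ht, rfl⟩, rfl⟩
        · exact Or.inl rfl
        · exact Or.inr ⟨t, ht, by omega⟩

theorem pos_of_mem_plus {l : List ℕ} (h : ∀ a ∈ l, 0 < a) : ∀ a ∈ plus l, 0 < a := by
  cases l <;> simp_all [plus]

theorem pos_of_mem_partialSums {l : List ℕ} (h : ∀ a ∈ l, 0 < a) {s : ℕ}
    (hs : s ∈ partialSums l) : 0 < s ∧ s < l.sum := by
  induction l generalizing s with
  | nil => simp [partialSums] at hs
  | cons a l ih =>
    have ha : 0 < a := h a (by simp)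
    have hl : ∀ b ∈ l, 0 < b := fun b hb => h b (by simp [hb])
    rcases eq_or_ne l [] with rfl | hne
    · simp [partialSums_singleton] at hs
    · rw [mem_partialSums_cons _ _ hne] at hs
      rw [List.sum_cons]
      rcases hs with rfl | ⟨t, ht, rfl⟩
      · have : 0 < l.sum := by
          obtain ⟨b, l', rfl⟩ := List.exists_cons_of_ne_nil hne
          have := hl b (by simp)
          simp; omega
        omega
      · have := ih hl ht
        omega

theorem hoffmanDual_aux (k : List ℕ) (h : ∀ a ∈ k, 0 < a) :
    (∀ a ∈ hoffmanDual k, 0 < a) ∧ (hoffmanDual k).sum = k.sum ∧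
      ∀ s, s ∈ partialSums (hoffmanDual k) ↔ (0 < s ∧ s < k.sum ∧ s ∉ partialSums k) := by
  induction k with
  | nil => simp [hoffmanDual, partialSums]
  | cons a l ih =>
    have ha : 0 < a := h a (by simp)
    obtain ⟨ih1, ih2, ih3⟩ := ih fun b hb => h b (by simp [hb])
    obtain ⟨m, rfl⟩ : ∃ m, a = m + 1 := ⟨a - 1, by omega⟩
    clear h ha
    induction m with
    | zero =>
      have e : hoffmanDual ((0 + 1) :: l) = plus (hoffmanDual l) := by simp [hoffmanDual]
      rw [e]
      refine ⟨pos_of_mem_plus ih1, by simp only [sum_plus, ih2, List.sum_cons]; omega, fun s => ?_⟩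
      rw [mem_partialSums_plus]
      rcases eq_or_ne l [] with rfl | hne
      · simp [hoffmanDual, partialSums]
        omega
      · rw [mem_partialSums_cons _ _ hne, List.sum_cons]
        constructor
        · rintro ⟨t, ht, rfl⟩
          have := (ih3 t).1 ht
          refine ⟨by omega, by omega, ?_⟩
          rintro (h | ⟨u, hu, h⟩)
          · omega
          · obtain rfl : u = t := by omega
            exact this.2.2 hu
        · rintro ⟨h1, h2, h3⟩
          push Not at h3
          refine ⟨s - 1, (ih3 _).2 ⟨by omega, by omega, fun h => ?_⟩, by omega⟩
          exact h3.2 _ h (by omega)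
    | succ m ihm =>
      have e : hoffmanDual ((m + 1 + 1) :: l) = 1 :: hoffmanDual ((m + 1) :: l) := by
        simp [hoffmanDual, List.replicate_succ]
      have e' : (m + 1 + 1) :: l = plus ((m + 1) :: l) := rfl
      obtain ⟨j1, j2, j3⟩ := ihm
      have hne : hoffmanDual ((m + 1) :: l) ≠ [] := by
        simp [hoffmanDual, plus_ne_nil]
      rw [e]
      refine ⟨?_, by simp only [List.sum_cons] at j2 ⊢; omega, fun s => ?_⟩
      · intro b hb
        rcases List.mem_cons.1 hb with rfl | hb
        · exact Nat.one_pos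
        · exact j1 b hb
      · rw [mem_partialSums_cons _ _ hne, e', mem_partialSums_plus, sum_plus]
        have hp : 0 < ((m + 1) :: l).sum := by rw [List.sum_cons]; omega
        constructor
        · rintro (rfl | ⟨t, ht, rfl⟩)
          · refine ⟨by omega, by omega, ?_⟩
            rintro ⟨t, ⟨j, h1, h2, h3⟩, h⟩
            obtain ⟨i, rfl⟩ : ∃ i, j = i + 1 := ⟨j - 1, by omega⟩
            simp at h3
            omega
          · have := (j3 t).1 ht
            refine ⟨by omega, by omega, ?_⟩
            rintro ⟨u, hu, h⟩
            obtain rfl : u = t := by omega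
            exact this.2.2 hu
        · rintro ⟨h1, h2, h3⟩
          push Not at h3
          by_cases hs : s = 1
          · exact Or.inl hs
          · exact Or.inr ⟨s - 1, (j3 _).2 ⟨by omega, by omega, fun h => h3 _ h (by omega)⟩,
              by omega⟩

theorem eq_of_partialSums_eq (k l : List ℕ) (hk : IsComposition k) (hl : IsComposition l)
    (hs : k.sum = l.sum) (hP : partialSums k = partialSums l) : k = l := by
  induction k generalizing l with
  | nil => exact absurd rfl hk.1
  | cons a k ih =>
    obtain ⟨b, l, rfl⟩ := List.exists_cons_of_ne_nil hl.1
    have hk' : ∀ c ∈ k, 0 < c := fun c hc => hk.2 c (by simp [hc])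
    have hl' : ∀ c ∈ l, 0 < c := fun c hc => hl.2 c (by simp [hc])
    rcases eq_or_ne k [] with rfl | hk0 <;> rcases eq_or_ne l [] with rfl | hl0
    · simpa using hs
    · have : b ∈ partialSums (b :: l) := (mem_partialSums_cons _ _ hl0 _).2 (Or.inl rfl)
      rw [← hP, partialSums_singleton] at this
      exact this.elim
    · have : a ∈ partialSums (a :: k) := (mem_partialSums_cons _ _ hk0 _).2 (Or.inl rfl)
      rw [hP, partialSums_singleton] at this
      exact this.elim
    · have hmem : ∀ s, (s = a ∨ ∃ t ∈ partialSums k, s = a + t) ↔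
          (s = b ∨ ∃ t ∈ partialSums l, s = b + t) := fun s => by
        rw [← mem_partialSums_cons _ _ hk0, ← mem_partialSums_cons _ _ hl0, hP]
      have hab : a = b := by
        have h1 : b ≤ a := by
          rcases (hmem a).1 (Or.inl rfl) with h | ⟨t, -, h⟩ <;> omega
        have h2 : a ≤ b := by
          rcases (hmem b).2 (Or.inl rfl) with h | ⟨t, -, h⟩ <;> omega
        omega
      subst hab
      have : k = l := by
        refine ih l ⟨hk0, hk'⟩ ⟨hl0, hl'⟩ (by simpa using hs) (Set.ext fun s => ?_)
        constructor
        · intro h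
          rcases (hmem (a + s)).1 (Or.inr ⟨s, h, rfl⟩) with h' | ⟨t, ht, h'⟩
          · have := (pos_of_mem_partialSums hk' h).1
            omega
          · obtain rfl : s = t := by omega
            exact ht
        · intro h
          rcases (hmem (a + s)).2 (Or.inr ⟨s, h, rfl⟩) with h' | ⟨t, ht, h'⟩
          · have := (pos_of_mem_partialSums hl' h).1
            omega
          · obtain rfl : s = t := by omega
            exact ht
      rw [this]

/-- `hoffmanDual k` is the unique composition of the same weight as `k` whose proper partial sums
form the complement of those of `k` in `{1, …, |k| - 1}`. -/
theorem isHoffmanDual_iff (k k' : List ℕ) (hk : IsComposition k) :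
    IsHoffmanDual k k' ↔ k' = hoffmanDual k := by
  obtain ⟨h1, h2, h3⟩ := hoffmanDual_aux k hk.2
  have hne : hoffmanDual k ≠ [] := by
    obtain ⟨a, l, rfl⟩ := List.exists_cons_of_ne_nil hk.1
    simp [hoffmanDual, plus_ne_nil]
  constructor
  · rintro ⟨c1, c2, c3, c4⟩
    refine eq_of_partialSums_eq _ _ c1 ⟨hne, h1⟩ (c2.trans h2.symm) (Set.ext fun s => ?_)
    rw [h3]
    constructor
    · intro hs
      have := pos_of_mem_partialSums c1.2 hs
      exact ⟨this.1, by omega, fun h => Set.disjoint_left.1 c3 h hs⟩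
    · rintro ⟨p1, p2, p3⟩
      have : s ∈ partialSums k ∪ partialSums k' := by
        rw [c4]
        exact ⟨p1, by omega⟩
      exact this.resolve_left p3
  · rintro rfl
    refine ⟨⟨hne, h1⟩, h2, Set.disjoint_left.2 fun s hs hs' => ((h3 s).1 hs').2.2 hs,
      Set.ext fun s => ?_⟩
    rw [Set.mem_union, h3, Set.mem_Icc]
    constructor
    · rintro (hs | hs)
      · have := pos_of_mem_partialSums hk.2 hs
        omega
      · omega
    · intro hs
      by_cases h : s ∈ partialSums k
      · exact Or.inl h
      · exact Or.inr ⟨by omega, by omega, h⟩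

/-- `B(k; j) = ∏ᵢ binom(kᵢ + jᵢ - 1, jᵢ)`, for lists of equal length. -/
def B (k j : List ℕ) : ℕ := (List.zipWith (fun a b => (a + b - 1).choose b) k j).prod

/-- Componentwise sum `k + j`, for lists of equal length. -/
def add (k j : List ℕ) : List ℕ := List.zipWith (fun a b => a + b) k j

/-! ## Multiple zeta values, multiple `T`-values, multiple polylogarithms -/

/-- The index set `n₁ > ⋯ > n_r > 0`. -/
def zetaIndex (r : ℕ) : Set (Fin r → ℕ) := {n | StrictAnti n ∧ ∀ i, 0 < n i}

/-- The index set `n₁ > ⋯ > n_r > 0`, `n_j ≡ r + 1 - j (mod 2)` (here `i = j - 1`). -/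
def tIndex (r : ℕ) : Set (Fin r → ℕ) :=
  {n | n ∈ zetaIndex r ∧ ∀ i : Fin r, n i ≡ r - (i : ℕ) [MOD 2]}

/-- `n₁^k₁ ⋯ n_r^k_r`. -/
def monomial (k : List ℕ) (n : Fin k.length → ℕ) : ℝ := ∏ i, (n i : ℝ) ^ k.get i

/-- The first entry `n₁` of a tuple (`0` for the empty tuple). -/
def first {r : ℕ} (n : Fin r → ℕ) : ℕ := if h : 0 < r then n ⟨0, h⟩ else 0

/-- The terms of the series `ζ(k)`. -/
def zetaTerm (k : List ℕ) (n : zetaIndex k.length) : ℝ := 1 / monomial k n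

/-- The multiple zeta value `ζ(k)`. -/
def zeta (k : List ℕ) : ℝ := ∑' n, zetaTerm k n

/-- The terms of the series `T(k)`. -/
def tTerm (k : List ℕ) (n : tIndex k.length) : ℝ := 2 ^ k.length / monomial k n

/-- The multiple `T`-value `T(k)`. -/
def tValue (k : List ℕ) : ℝ := ∑' n, tTerm k n

/-- The terms of the series `Li_k(x)`. -/
def liTerm (k : List ℕ) (x : ℝ) (n : zetaIndex k.length) : ℝ := x ^ first n.1 / monomial k n

/-- The multiple polylogarithm `Li_k(x)`, for `|x| < 1`. -/
def Li (k : List ℕ) (x : ℝ) : ℝ := ∑' n, liTerm k x n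

/-- The terms of the series `A(k; x)`. -/
def aTerm (k : List ℕ) (x : ℝ) (n : tIndex k.length) : ℝ :=
  2 ^ k.length * (x ^ first n.1 / monomial k n)

/-- The level two analogue `A(k; x)` of the multiple polylogarithm,
for `|x| < 1`. -/
def A (k : List ℕ) (x : ℝ) : ℝ := ∑' n, aTerm k x n

/-! ## The Arakawa–Kaneko zeta function and the Kaneko–Tsumura `ψ`-function -/

/-- `t^{s-1} / (e^t - 1) · Li_k(1 - e^{-t})`. -/
def xiIntegrand (s : ℂ) (k : List ℕ) (t : ℝ) : ℂ :=
  (t : ℂ) ^ (s - 1) / ((Real.exp t - 1 : ℝ) : ℂ) * ((Li k (1 - Real.exp (-t)) : ℝ) : ℂ)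

/-- The Arakawa–Kaneko zeta function `ξ(s; k)` (for `Re s > 0`). -/
def xi (s : ℂ) (k : List ℕ) : ℂ :=
  1 / Complex.Gamma s * ∫ t in Set.Ioi (0 : ℝ), xiIntegrand s k t

/-- `t^{s-1} · A(k; tanh(t/2)) / sinh t`. -/
def psiIntegrand (s : ℂ) (k : List ℕ) (t : ℝ) : ℂ :=
  (t : ℂ) ^ (s - 1) * (((A k (Real.tanh (t / 2)) : ℝ) : ℂ) / ((Real.sinh t : ℝ) : ℂ))

/-- The Kaneko–Tsumura `ψ`-function `ψ(s; k)` (for `Re s > 0`). -/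
def psi (s : ℂ) (k : List ℕ) : ℂ :=
  1 / Complex.Gamma s * ∫ t in Set.Ioi (0 : ℝ), psiIntegrand s k t

/-- `(k̄^∨)₊`. -/
def dualPlus (k : List ℕ) : List ℕ := plus (hoffmanDual k.reverse)

end ArakawaKaneko

end

namespace ArakawaKaneko

open MeasureTheory Set Filter Topology
open scoped ENNReal

noncomputable section

/-! Both formulas are treated at once, with level p = 1 for ξ and ζ and p = 2 for ψ and T. The
exponential generating function in y of the moments over t, after u = exp(-t), becomes an integral
over (0, 1) of u^(-y) times p/(1 - u^p) times the polylogarithm of the given index at σ(u), where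
σ(u) = 1 - u or (1 - u)/(1 + u) (`tsum_moment`).

A polylogarithm is an iterated integral of the forms dx/x and p dx/(1 - x^p), and σ exchanges these
forms. Removing the outermost form on the reflected side and applying Tonelli on a triangle
transfers it, exchanged, to the other factor (`pairing_extend`). Starting from u^(-y) instead of 1
replaces every summation variable n by n - y. Once all forms have been transferred, what remains is
the series of the index `dualPlus` at 1, with each n_i replaced by n_i - y (`pairing_eq_dualPlus`).

The binomial series for 1/(n - y)^a then produces the factors B and the raised exponents
(`polySeries_one_eq_tsum`), and comparing coefficients of y^k gives the theorem (`moment_eq`). All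
of this takes place in [0, ∞], where interchanges need no convergence hypothesis. Finiteness is
proved only for the series (`polySeries_one_ne_top`), and integrability follows from the resulting
equality. -/

/-- Indicator of the pairs `m < N` with `N ≡ m + 1` modulo `p`. -/
def step (p m N : ℕ) : ℝ≥0∞ := if m < N ∧ N ≡ m + 1 [MOD p] then 1 else 0

/-- The coefficient of `x ^ (N - y)` in the deformed polylogarithm of level `p`. -/
def coeff (p : ℕ) (y : ℝ) : List ℕ → ℕ → ℝ≥0∞
  | [], N => if N = 0 then 1 else 0
  | a :: l, N => p * ENNReal.ofReal (((N : ℝ) - y)⁻¹) ^ a * ∑' m, step p m N * coeff p y l m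

/-- The multiple polylogarithm of level `p`, with every summation variable shifted by `-y`. -/
def polySeries (p : ℕ) (y : ℝ) (l : List ℕ) (x : ℝ) : ℝ≥0∞ :=
  ∑' N : ℕ, coeff p y l N * ENNReal.ofReal (x ^ ((N : ℝ) - y))

/-- The density of the differential form of level `p` with a pole at `1`. -/
def dens (p : ℕ) (x : ℝ) : ℝ := p / (1 - x ^ p)

/-! ### Integration of deformed polylogarithms against dx/x and p dx/(1 - x^p) -/

theorem coeff_cons_zero (p : ℕ) (y : ℝ) (a : ℕ) (l : List ℕ) : coeff p y (a :: l) 0 = 0 := by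
  simp [coeff, step]

theorem coeff_plus (p : ℕ) (y : ℝ) {l : List ℕ} (hl : l ≠ []) (N : ℕ) :
    coeff p y (plus l) N = ENNReal.ofReal (((N : ℝ) - y)⁻¹) * coeff p y l N := by
  obtain ⟨a, l, rfl⟩ := List.exists_cons_of_ne_nil hl
  simp only [plus, coeff, pow_succ]
  ring

theorem lintegral_Ioo_rpow {c x : ℝ} (hc : 0 < c) (hx : 0 ≤ x) :
    ∫⁻ u in Ioo 0 x, ENNReal.ofReal (u ^ (c - 1)) = ENNReal.ofReal c⁻¹ * ENNReal.ofReal (x ^ c) := by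
  have hi : IntervalIntegrable (fun u : ℝ => u ^ (c - 1)) volume 0 x :=
    intervalIntegral.intervalIntegrable_rpow' (by linarith)
  rw [← ofReal_integral_eq_lintegral_ofReal, ← integral_Ioc_eq_integral_Ioo,
    ← intervalIntegral.integral_of_le hx, integral_rpow (Or.inl (by linarith)),
    ← ENNReal.ofReal_mul (by positivity)]
  · congr 1
    rw [sub_add_cancel, Real.zero_rpow hc.ne']
    field_simp
    ring
  · exact ((intervalIntegrable_iff_integrableOn_Ioc_of_le hx).1 hi).mono_set Ioo_subset_Ioc_self
  · exact (ae_restrict_iff' measurableSet_Ioo).2 (ae_of_all _ fun u hu => Real.rpow_nonneg hu.1.le _)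

theorem measurable_polySeries (p : ℕ) (y : ℝ) (l : List ℕ) : Measurable (polySeries p y l) := by
  unfold polySeries
  refine Measurable.tsum fun N => ?_
  fun_prop

theorem measurable_dens (p : ℕ) : Measurable (dens p) := by
  unfold dens
  fun_prop

/-- Termwise integration: each power u^(N - y - 1) contributes a factor 1/(N - y). A nonempty index
has no term N = 0, and N - y > 0 for N ≥ 1. -/
theorem lintegral_polySeries_inv (p : ℕ) {y : ℝ} (hy : y < 1) {l : List ℕ} (hl : l ≠ []) {x : ℝ}
    (hx : 0 ≤ x) :
    ∫⁻ u in Ioo 0 x, ENNReal.ofReal u⁻¹ * polySeries p y l u = polySeries p y (plus l) x := by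
  have h1 : ∫⁻ u in Ioo 0 x, ENNReal.ofReal u⁻¹ * polySeries p y l u =
      ∫⁻ u in Ioo 0 x, ∑' N : ℕ, coeff p y l N * ENNReal.ofReal (u ^ (((N : ℝ) - y) - 1)) := by
    refine setLIntegral_congr_fun measurableSet_Ioo fun u hu => ?_
    simp only [polySeries, ← ENNReal.tsum_mul_left]
    refine tsum_congr fun N => ?_
    rw [Real.rpow_sub_one hu.1.ne', div_eq_mul_inv, ENNReal.ofReal_mul (Real.rpow_nonneg hu.1.le _)]
    ring
  rw [h1, lintegral_tsum (fun N => by fun_prop), polySeries]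
  refine tsum_congr fun N => ?_
  rw [lintegral_const_mul _ (by fun_prop), coeff_plus p y hl]
  rcases Nat.eq_zero_or_pos N with rfl | hN
  · obtain ⟨a, l, rfl⟩ := List.exists_cons_of_ne_nil hl
    simp [coeff_cons_zero]
  · have : (1 : ℝ) ≤ N := by exact_mod_cast hN
    rw [lintegral_Ioo_rpow (by linarith) hx]
    ring

theorem tsum_step_mul {p : ℕ} (hp : 0 < p) (m : ℕ) (f : ℕ → ℝ≥0∞) :
    ∑' N, step p m N * f N = ∑' i, f (m + 1 + p * i) := by
  have hinj : Function.Injective fun i : ℕ => m + 1 + p * i := fun i j h => by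
    simpa [hp.ne'] using h
  rw [← hinj.tsum_eq]
  · refine tsum_congr fun i => ?_
    have : m < m + 1 + p * i ∧ m + 1 + p * i ≡ m + 1 [MOD p] :=
      ⟨by omega, by simp [Nat.ModEq]⟩
    simp [step, this]
  · intro N hN
    have h : m < N ∧ N ≡ m + 1 [MOD p] := by
      by_contra h
      simp [step, h] at hN
    obtain ⟨i, hi⟩ := (Nat.modEq_iff_dvd' (Nat.succ_le_of_lt h.1)).1 h.2.symm
    exact ⟨i, by simp only [← hi]; have := h.1; omega⟩

/-- The geometric series in u^p: its exponents run through m, m + p, m + 2p, …, which is the source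
of the congruence in `step`. -/
theorem ofReal_dens_mul_rpow {p : ℕ} (hp : 0 < p) (m : ℕ) (y : ℝ) {u : ℝ} (hu : u ∈ Ioo (0 : ℝ) 1) :
    ENNReal.ofReal (dens p u) * ENNReal.ofReal (u ^ ((m : ℝ) - y)) =
      ∑' N : ℕ, step p m N * (p * ENNReal.ofReal (u ^ (((N : ℝ) - y) - 1))) := by
  have hup : u ^ p < 1 := pow_lt_one₀ hu.1.le hu.2 hp.ne'
  have hup0 : 0 ≤ u ^ p := pow_nonneg hu.1.le _
  rw [tsum_step_mul hp]
  have h : ∀ i : ℕ, (p : ℝ≥0∞) * ENNReal.ofReal (u ^ ((((m + 1 + p * i : ℕ) : ℝ) - y) - 1)) =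
      ENNReal.ofReal (u ^ ((m : ℝ) - y)) * (p * ENNReal.ofReal (u ^ p) ^ i) := fun i => by
    have : (((m + 1 + p * i : ℕ) : ℝ) - y) - 1 = ((m : ℝ) - y) + (p * i : ℕ) := by push_cast; ring
    rw [this, Real.rpow_add hu.1, Real.rpow_natCast, pow_mul,
      ENNReal.ofReal_mul (Real.rpow_nonneg hu.1.le _), ENNReal.ofReal_pow hup0]
    ring
  simp only [h]
  rw [ENNReal.tsum_mul_left, ENNReal.tsum_mul_left, ENNReal.tsum_geometric, mul_comm, dens,
    ENNReal.ofReal_div_of_pos (by linarith), ENNReal.ofReal_natCast, ENNReal.ofReal_sub _ hup0,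
    ENNReal.ofReal_one, div_eq_mul_inv]

theorem lintegral_polySeries_dens {p : ℕ} (hp : 0 < p) {y : ℝ} (hy : y < 1) (l : List ℕ) {x : ℝ}
    (hx : x ∈ Icc (0 : ℝ) 1) :
    ∫⁻ u in Ioo 0 x, ENNReal.ofReal (dens p u) * polySeries p y l u =
      polySeries p y (1 :: l) x := by
  have h1 : ∫⁻ u in Ioo 0 x, ENNReal.ofReal (dens p u) * polySeries p y l u =
      ∫⁻ u in Ioo 0 x, ∑' N : ℕ, (∑' m, step p m N * coeff p y l m) *
        (p * ENNReal.ofReal (u ^ (((N : ℝ) - y) - 1))) := by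
    refine setLIntegral_congr_fun measurableSet_Ioo fun u hu => ?_
    have hu' : u ∈ Ioo (0 : ℝ) 1 := ⟨hu.1, hu.2.trans_le hx.2⟩
    simp only [polySeries, ← ENNReal.tsum_mul_left, ← ENNReal.tsum_mul_right]
    rw [ENNReal.tsum_comm]
    refine tsum_congr fun m => ?_
    rw [mul_left_comm, ofReal_dens_mul_rpow hp m y hu', ← ENNReal.tsum_mul_left]
    refine tsum_congr fun N => ?_
    ring
  rw [h1, lintegral_tsum (fun N => by fun_prop), polySeries]
  refine tsum_congr fun N => ?_
  rw [lintegral_const_mul _ (by fun_prop), lintegral_const_mul _ (by fun_prop)]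
  rcases Nat.eq_zero_or_pos N with rfl | hN
  · simp [step, coeff]
  · have : (1 : ℝ) ≤ N := by exact_mod_cast hN
    rw [lintegral_Ioo_rpow (by linarith) hx.1, coeff]
    ring

/-! ### The involution and its action on the two forms -/

/-- The involution of `(0, 1)` exchanging `dx / x` and `dens p x dx` for `p = 1, 2`. -/
def invol (p : ℕ) (x : ℝ) : ℝ := (1 - x) / (1 + ((p : ℝ) - 1) * x)

/-- The densities of the two differential forms of level `p`. -/
def form (p : ℕ) (b : Bool) (x : ℝ) : ℝ≥0∞ :=
  bif b then ENNReal.ofReal (dens p x) else ENNReal.ofReal x⁻¹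

/-- The index obtained by integrating against `form p b`. -/
def extend (b : Bool) (l : List ℕ) : List ℕ := bif b then 1 :: l else plus l

theorem extend_ne_nil (b : Bool) (l : List ℕ) : extend b l ≠ [] := by
  cases b <;> simp [extend, plus_ne_nil]

theorem measurable_form (p : ℕ) (b : Bool) : Measurable (form p b) := by
  cases b
  · exact measurable_inv.ennreal_ofReal
  · exact (measurable_dens p).ennreal_ofReal

theorem measurable_invol (p : ℕ) : Measurable (invol p) := by
  unfold invol
  fun_prop

theorem lintegral_form_mul_polySeries {p : ℕ} (hp : 0 < p) {y : ℝ} (hy : y < 1) {b : Bool}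
    {l : List ℕ} (h : b = true ∨ l ≠ []) {x : ℝ} (hx : x ∈ Icc (0 : ℝ) 1) :
    ∫⁻ u in Ioo 0 x, form p b u * polySeries p y l u = polySeries p y (extend b l) x := by
  cases b
  · exact lintegral_polySeries_inv p hy (by simpa using h) hx.1
  · exact lintegral_polySeries_dens hp hy l hx

theorem one_add_mul_pos {p : ℕ} (hp : p = 1 ∨ p = 2) {x : ℝ} (hx : 0 < x) :
    0 < 1 + ((p : ℝ) - 1) * x := by
  rcases hp with rfl | rfl <;> norm_num
  all_goals linarith

theorem invol_mem {p : ℕ} (hp : p = 1 ∨ p = 2) {x : ℝ} (hx : x ∈ Ioo (0 : ℝ) 1) :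
    invol p x ∈ Ioo (0 : ℝ) 1 := by
  have h := one_add_mul_pos hp hx.1
  have := hx.1
  have := hx.2
  refine ⟨div_pos (by linarith) h, (div_lt_one h).2 ?_⟩
  rcases hp with rfl | rfl <;> norm_num
  all_goals linarith

theorem invol_invol {p : ℕ} (hp : p = 1 ∨ p = 2) {x : ℝ} (hx : x ∈ Ioo (0 : ℝ) 1) :
    invol p (invol p x) = x := by
  have h0 := hx.1
  rcases hp with rfl | rfl
  · simp [invol]
  · have : (1 : ℝ) + x ≠ 0 := by linarith
    norm_num [invol]
    field_simp
    ring_nf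

theorem invol_lt_invol {p : ℕ} (hp : p = 1 ∨ p = 2) {x z : ℝ} (hx : 0 < x) (hxz : x < z) :
    invol p z < invol p x := by
  unfold invol
  rw [div_lt_div_iff₀ (one_add_mul_pos hp (hx.trans hxz)) (one_add_mul_pos hp hx)]
  rcases hp with rfl | rfl <;> norm_num <;> nlinarith

theorem image_invol {p : ℕ} (hp : p = 1 ∨ p = 2) {u : ℝ} (hu : u ∈ Ioo (0 : ℝ) 1) :
    invol p '' Ioo u 1 = Ioo 0 (invol p u) := by
  ext s
  constructor
  · rintro ⟨v, hv, rfl⟩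
    exact ⟨(invol_mem hp ⟨hu.1.trans hv.1, hv.2⟩).1, invol_lt_invol hp hu.1 hv.1⟩
  · intro hs
    have hs' : s ∈ Ioo (0 : ℝ) 1 := ⟨hs.1, hs.2.trans (invol_mem hp hu).2⟩
    refine ⟨invol p s, ⟨?_, (invol_mem hp hs').2⟩, invol_invol hp hs'⟩
    have := invol_lt_invol hp hs.1 hs.2
    rwa [invol_invol hp hu] at this

theorem hasDerivAt_invol {p : ℕ} (hp : p = 1 ∨ p = 2) {x : ℝ} (hx : 0 < x) :
    HasDerivAt (invol p) (-(p / (1 + ((p : ℝ) - 1) * x) ^ 2)) x := by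
  have h := one_add_mul_pos hp hx
  have h1 : HasDerivAt (fun x : ℝ => 1 - x) (-1) x := by
    simpa using (hasDerivAt_id x).const_sub 1
  have h2 : HasDerivAt (fun x : ℝ => 1 + ((p : ℝ) - 1) * x) ((p : ℝ) - 1) x := by
    simpa using ((hasDerivAt_id x).const_mul ((p : ℝ) - 1)).const_add 1
  refine (h1.div h2 h.ne').congr_deriv ?_
  rw [← neg_div]
  congr 1
  ring

/-- The exchange of the two forms under pullback, checked by hand for each level. This is where p =
1, 2 are special. -/
theorem deriv_mul_form {p : ℕ} (hp : p = 1 ∨ p = 2) (b : Bool) {x : ℝ} (hx : x ∈ Ioo (0 : ℝ) 1) :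
    ENNReal.ofReal |-((p : ℝ) / (1 + ((p : ℝ) - 1) * x) ^ 2)| * form p b (invol p x) =
      form p (!b) x := by
  have h0 := hx.1
  have h1 : 0 < 1 - x := sub_pos.2 hx.2
  have h2 : 0 < 1 + x := by linarith
  have h3 : (1 - x ^ 2) = (1 - x) * (1 + x) := by ring
  rw [abs_neg, abs_of_nonneg (by positivity)]
  cases b
  · simp only [form, cond_false, Bool.not_false, cond_true]
    rw [← ENNReal.ofReal_mul (by positivity)]
    congr 1
    rcases hp with rfl | rfl
    · simp [invol, dens]
    · norm_num [invol, dens, h3]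
      field_simp
  · simp only [form, cond_false, Bool.not_true, cond_true]
    rw [← ENNReal.ofReal_mul (by positivity)]
    congr 1
    rcases hp with rfl | rfl
    · simp [invol, dens]
    · have h4 : (1 + x) ^ 2 - (1 - x) ^ 2 = 4 * x := by ring
      have h5 : 1 - ((1 - x) / (1 + x)) ^ 2 = 4 * x / (1 + x) ^ 2 := by
        rw [div_pow, ← h4]
        field_simp
      norm_num [invol, dens]
      rw [h5]
      field_simp
      norm_num

theorem lintegral_form_comp_invol {p : ℕ} (hp : p = 1 ∨ p = 2) (b : Bool) (f : ℝ → ℝ≥0∞) {u : ℝ}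
    (hu : u ∈ Ioo (0 : ℝ) 1) :
    ∫⁻ s in Ioo 0 (invol p u), form p b s * f s =
      ∫⁻ v in Ioo u 1, form p (!b) v * f (invol p v) := by
  have h : ∀ v ∈ Ioo u 1, v ∈ Ioo (0 : ℝ) 1 := fun v hv => ⟨hu.1.trans hv.1, hv.2⟩
  rw [← image_invol hp hu, lintegral_image_eq_lintegral_abs_deriv_mul measurableSet_Ioo
    (fun v hv => (hasDerivAt_invol hp (h v hv).1).hasDerivWithinAt)]
  · refine setLIntegral_congr_fun measurableSet_Ioo fun v hv => ?_
    simp only [← deriv_mul_form hp b (h v hv)]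
    ring
  · intro v hv w hw hvw
    rw [← invol_invol hp (h v hv), hvw, invol_invol hp (h w hw)]

/-! ### Transfer of forms across the pairing, and the Hoffman dual -/

theorem lintegral_Ioo_mul_lintegral_swap {f g : ℝ → ℝ≥0∞} (hf : Measurable f) (hg : Measurable g) :
    ∫⁻ u in Ioo (0 : ℝ) 1, f u * ∫⁻ v in Ioo u 1, g v =
      ∫⁻ v in Ioo (0 : ℝ) 1, g v * ∫⁻ u in Ioo 0 v, f u := by
  have hS : MeasurableSet {q : ℝ × ℝ | 0 < q.1 ∧ q.1 < q.2 ∧ q.2 < 1} := by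
    refine MeasurableSet.inter (measurableSet_lt measurable_const measurable_fst)
      (MeasurableSet.inter (measurableSet_lt measurable_fst measurable_snd)
        (measurableSet_lt measurable_snd measurable_const))
  -- Both iterated integrals are integrals of the same function over the triangle 0 < u < v < 1.
  set F : ℝ × ℝ → ℝ≥0∞ := {q : ℝ × ℝ | 0 < q.1 ∧ q.1 < q.2 ∧ q.2 < 1}.indicator
    fun q => f q.1 * g q.2 with hF
  have hFm : Measurable F :=
    ((hf.comp measurable_fst).mul (hg.comp measurable_snd)).indicator hS
  have h1 : ∫⁻ u in Ioo (0 : ℝ) 1, f u * ∫⁻ v in Ioo u 1, g v = ∫⁻ u, ∫⁻ v, F (u, v) := by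
    rw [← lintegral_indicator measurableSet_Ioo]
    refine lintegral_congr fun u => ?_
    by_cases hu : u ∈ Ioo (0 : ℝ) 1
    · rw [indicator_of_mem hu, ← lintegral_const_mul _ hg, ← lintegral_indicator measurableSet_Ioo]
      refine lintegral_congr fun v => ?_
      simp [hF, indicator, hu.1]
    · rw [indicator_of_notMem hu]
      symm
      convert lintegral_zero with v
      simp only [hF, indicator, mem_ofPred_eq]
      rw [if_neg]
      exact fun h => hu ⟨h.1, h.2.1.trans h.2.2⟩
  have h2 : ∫⁻ v in Ioo (0 : ℝ) 1, g v * ∫⁻ u in Ioo 0 v, f u = ∫⁻ v, ∫⁻ u, F (u, v) := by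
    rw [← lintegral_indicator measurableSet_Ioo]
    refine lintegral_congr fun v => ?_
    by_cases hv : v ∈ Ioo (0 : ℝ) 1
    · rw [indicator_of_mem hv, ← lintegral_const_mul _ hf, ← lintegral_indicator measurableSet_Ioo]
      refine lintegral_congr fun u => ?_
      simp [hF, indicator, hv.2, mul_comm]
    · rw [indicator_of_notMem hv]
      symm
      convert lintegral_zero with u
      simp only [hF, indicator, mem_ofPred_eq]
      rw [if_neg]
      exact fun h => hv ⟨h.1.trans h.2.1, h.2.2⟩
  rw [h1, h2]
  exact lintegral_lintegral_swap hFm.aemeasurable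

/-- The pairing of a deformed polylogarithm with the reflection of an ordinary one. -/
def pairing (p : ℕ) (y : ℝ) (b : Bool) (l a : List ℕ) : ℝ≥0∞ :=
  ∫⁻ u in Ioo (0 : ℝ) 1, (form p b u * polySeries p y a u) * polySeries p 0 l (invol p u)

theorem pairing_nil {p : ℕ} (hp : p = 1 ∨ p = 2) {y : ℝ} (hy : y < 1) {b : Bool} {a : List ℕ}
    (h : b = true ∨ a ≠ []) : pairing p y b [] a = polySeries p y (extend b a) 1 := by
  have hp0 : 0 < p := by omega
  rw [← lintegral_form_mul_polySeries hp0 hy h ⟨zero_le_one, le_rfl⟩, pairing]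
  refine setLIntegral_congr_fun measurableSet_Ioo fun u hu => ?_
  have : polySeries p 0 [] (invol p u) = 1 := by
    rw [polySeries, tsum_eq_single 0]
    · simp [coeff]
    · intro N hN
      simp [coeff, hN]
  simp [this]

/-- The duality step. The reflected factor at u is an integral over (u, 1) of the exchanged form;
after swapping the order of integration, the inner integral over (0, v) completes the pending form
`b` on the deformed side, and `!c` becomes the new pending form. -/
theorem pairing_extend {p : ℕ} (hp : p = 1 ∨ p = 2) {y : ℝ} (hy : y < 1) {b c : Bool}
    {a l : List ℕ} (hb : b = true ∨ a ≠ []) (hc : c = true ∨ l ≠ []) :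
    pairing p y b (extend c l) a = pairing p y (!c) l (extend b a) := by
  have hp0 : 0 < p := by omega
  have h1 : pairing p y b (extend c l) a = ∫⁻ u in Ioo (0 : ℝ) 1, (form p b u * polySeries p y a u) *
      ∫⁻ v in Ioo u 1, form p (!c) v * polySeries p 0 l (invol p v) := by
    refine setLIntegral_congr_fun measurableSet_Ioo fun u hu => ?_
    rw [← lintegral_form_comp_invol hp c _ hu, lintegral_form_mul_polySeries hp0 one_pos hc
      (Ioo_subset_Icc_self (invol_mem hp hu))]
  refine (h1.trans (lintegral_Ioo_mul_lintegral_swap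
    ((measurable_form p b).mul (measurable_polySeries p y a))
    ((measurable_form p _).mul
      ((measurable_polySeries p 0 l).comp (measurable_invol p))))).trans ?_
  refine setLIntegral_congr_fun measurableSet_Ioo fun v hv => ?_
  rw [lintegral_form_mul_polySeries hp0 hy hb (Ioo_subset_Icc_self hv)]
  ring

/-- An entry k is the word of k - 1 forms dx/x followed by one form p dx/(1 - x^p), read from the
outside. Exchanged, these put k - 1 ones in front and then raise the first entry. The operations on
the deformed side lag by one form, since the latest one is still pending in `b`. -/
theorem pairing_eq {p : ℕ} (hp : p = 1 ∨ p = 2) {y : ℝ} (hy : y < 1) (l : List ℕ)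
    (hl : ∀ k ∈ l, 0 < k) (b : Bool) (a : List ℕ) (h : b = true ∨ a ≠ []) :
    pairing p y b l a =
      polySeries p y (l.foldl (fun c k => plus (List.replicate (k - 1) 1 ++ c)) (extend b a)) 1 := by
  induction l generalizing b a with
  | nil => exact pairing_nil hp hy h
  | cons k l ih =>
    obtain ⟨m, rfl⟩ : ∃ m, k = m + 1 := ⟨k - 1, by have := hl k (by simp); omega⟩
    have hl' : ∀ k ∈ l, 0 < k := fun k hk => hl k (by simp [hk])
    clear hl
    induction m generalizing b a with
    | zero =>
      have : (0 + 1) :: l = extend true l := rfl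
      rw [this, pairing_extend hp hy h (Or.inl rfl), ih hl' _ _ (Or.inr (extend_ne_nil b a))]
      simp [extend]
    | succ m ihm =>
      have : (m + 1 + 1) :: l = extend false ((m + 1) :: l) := rfl
      rw [this, pairing_extend hp hy h (Or.inr (by simp)), ihm _ _ (Or.inr (extend_ne_nil b a))]
      simp [extend, plus, List.replicate_succ']

/-- Regroups the alternation of `plus` and blocks of ones, so that the last `plus` stands outside
and the rest has the shape of `hoffmanDual`. -/
theorem foldl_plus_eq (l c : List ℕ) :
    l.foldl (fun c k => plus (List.replicate (k - 1) 1 ++ c)) (plus c) =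
      plus (l.foldl (fun c k => List.replicate (k - 1) 1 ++ plus c) c) := by
  induction l generalizing c with
  | nil => rfl
  | cons k l ih => rw [List.foldl_cons, List.foldl_cons, ih]

theorem hoffmanDual_eq_foldr (l : List ℕ) :
    hoffmanDual l = l.foldr (fun k c => List.replicate (k - 1) 1 ++ plus c) [] := by
  induction l with
  | nil => rfl
  | cons k l ih => rw [hoffmanDual, List.foldr_cons, ih]

theorem pairing_eq_dualPlus {p : ℕ} (hp : p = 1 ∨ p = 2) {y : ℝ} (hy : y < 1) (l : List ℕ)
    (hl : ∀ k ∈ l, 0 < k) : pairing p y true l [] = polySeries p y (dualPlus l) 1 := by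
  -- The left fold over `l` is a right fold over its reversal; the initial index [1] is `plus []`.
  rw [pairing_eq hp hy l hl true [] (Or.inl rfl), dualPlus, hoffmanDual_eq_foldr, List.foldr_reverse]
  exact congrArg (fun a => polySeries p y a 1) (foldl_plus_eq l [])

/-! ### Expansion in powers of the deformation parameter -/

theorem ofReal_inv_sub_pow {y : ℝ} (hy0 : 0 ≤ y) (hy : y < 1) {a N : ℕ} (ha : 0 < a) (hN : 0 < N) :
    ENNReal.ofReal (((N : ℝ) - y)⁻¹) ^ a =
      ∑' j : ℕ, ENNReal.ofReal y ^ j * ((a + j - 1).choose j : ℝ≥0∞) *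
        ENNReal.ofReal (((N : ℝ) - 0)⁻¹) ^ (a + j) := by
  obtain ⟨k, rfl⟩ : ∃ k, a = k + 1 := ⟨a - 1, by omega⟩
  have hN1 : (1 : ℝ) ≤ N := by exact_mod_cast hN
  have hlt : y / N < 1 := (div_lt_one (by linarith)).2 (by linarith)
  -- Negative binomial series in y/N, after factoring N out of N - y.
  have h := (hasSum_choose_mul_geometric_of_norm_lt_one k (r := y / N)
    (by rwa [Real.norm_of_nonneg (by positivity)])).mul_left (((N : ℝ)⁻¹) ^ (k + 1))
  have h2 : ((N : ℝ)⁻¹) ^ (k + 1) * (1 / (1 - y / N) ^ (k + 1)) = (((N : ℝ) - y)⁻¹) ^ (k + 1) := by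
    rw [one_div, ← inv_pow, ← mul_pow, ← mul_inv]
    congr 2
    field_simp
  rw [h2] at h
  have hpos : 0 ≤ ((N : ℝ) - y)⁻¹ := inv_nonneg.2 (by linarith)
  rw [← ENNReal.ofReal_pow hpos, ← h.tsum_eq,
    ENNReal.ofReal_tsum_of_nonneg (fun j => by positivity) h.summable]
  refine tsum_congr fun j => ?_
  rw [sub_zero, ← ENNReal.ofReal_pow hy0, ← ENNReal.ofReal_pow (by positivity),
    ← ENNReal.ofReal_natCast, ← ENNReal.ofReal_mul (by positivity),
    ← ENNReal.ofReal_mul (by positivity)]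
  congr 1
  have h3 : (k + 1 + j - 1).choose j = (j + k).choose k := by
    rw [show k + 1 + j - 1 = j + k by omega, Nat.choose_symm_add]
  rw [h3, div_pow, inv_pow, inv_pow, pow_add _ (k + 1) j]
  field_simp

theorem tsum_fin_zero (f : (Fin 0 → ℕ) → ℝ≥0∞) : ∑' n, f n = f default :=
  tsum_eq_single default fun _ hn => (hn (Subsingleton.elim _ _)).elim

theorem tsum_fin_succ {r : ℕ} (f : (Fin (r + 1) → ℕ) → ℝ≥0∞) :
    ∑' n, f n = ∑' (N : ℕ) (n : Fin r → ℕ), f (Fin.cons N n) := by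
  rw [← (Fin.consEquiv fun _ : Fin (r + 1) => ℕ).tsum_eq, ENNReal.tsum_prod']
  rfl

theorem add_cons (a : ℕ) (l : List ℕ) (i : ℕ) (j : List ℕ) :
    add (a :: l) (i :: j) = (a + i) :: add l j := rfl

theorem B_cons (a : ℕ) (l : List ℕ) (i : ℕ) (j : List ℕ) :
    B (a :: l) (i :: j) = (a + i - 1).choose i * B l j := rfl

theorem coeff_eq_tsum (p : ℕ) {y : ℝ} (hy0 : 0 ≤ y) (hy : y < 1) (l : List ℕ)
    (hl : ∀ a ∈ l, 0 < a) (N : ℕ) :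
    coeff p y l N = ∑' j : Fin l.length → ℕ,
      ENNReal.ofReal y ^ (∑ i, j i) * ((B l (List.ofFn j) : ℝ≥0∞) *
        coeff p 0 (add l (List.ofFn j)) N) := by
  induction l generalizing N with
  | nil =>
    refine Eq.trans ?_ (tsum_fin_zero _).symm
    simp [B, add, coeff]
  | cons a l ih =>
    -- The expansion of 1/(N - y)^a needs N > 0; at N = 0 both sides vanish.
    rcases Nat.eq_zero_or_pos N with rfl | hN
    · rw [coeff_cons_zero]
      symm
      rw [ENNReal.tsum_eq_zero]
      intro j
      rw [List.ofFn_succ, add_cons, coeff_cons_zero]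
      simp
    · have ih' := ih fun b hb => hl b (by simp [hb])
      refine Eq.trans ?_ (tsum_fin_succ (r := l.length) _).symm
      rw [coeff, ofReal_inv_sub_pow hy0 hy (hl a (by simp)) hN, mul_assoc, ← ENNReal.tsum_mul_right, ← ENNReal.tsum_mul_left]
      refine tsum_congr fun i => ?_
      simp only [ih', ← ENNReal.tsum_mul_left]
      rw [ENNReal.tsum_comm]
      refine tsum_congr fun j => ?_
      have e : List.ofFn (Fin.cons i j : Fin (l.length + 1) → ℕ) =
          i :: List.ofFn j := by
        rw [List.ofFn_succ]
        rfl
      have e2 : ∑ t, (Fin.cons i j : Fin (l.length + 1) → ℕ) t = i + ∑ t, j t := by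
        rw [Fin.sum_univ_succ]
        rfl
      have e3 : ∀ f : Fin (l.length + 1) → ℕ, (∑ t : Fin (a :: l).length, f t) = ∑ t, f t :=
        fun _ => rfl
      rw [e3, e2, e, add_cons, B_cons, coeff, pow_add]
      simp only [ENNReal.tsum_mul_left.symm, Nat.cast_mul]
      refine tsum_congr fun m => ?_
      ring

theorem polySeries_one (p : ℕ) (y : ℝ) (l : List ℕ) : polySeries p y l 1 = ∑' N, coeff p y l N := by
  simp [polySeries]

theorem polySeries_one_eq_tsum (p : ℕ) {y : ℝ} (hy0 : 0 ≤ y) (hy : y < 1) (l : List ℕ)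
    (hl : ∀ a ∈ l, 0 < a) :
    polySeries p y l 1 = ∑' k : ℕ, ENNReal.ofReal y ^ k *
      ∑ j ∈ Finset.Nat.antidiagonalTuple l.length k,
        (B l (List.ofFn j) : ℝ≥0∞) * polySeries p 0 (add l (List.ofFn j)) 1 := by
  simp only [polySeries_one]
  simp_rw [coeff_eq_tsum p hy0 hy l hl]
  -- The tuples j are grouped by their total, which is the exponent of y.
  rw [ENNReal.tsum_comm, ← (Finset.Nat.sigmaAntidiagonalTupleEquivTuple l.length).tsum_eq,
    ENNReal.tsum_sigma']
  refine tsum_congr fun k => ?_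
  rw [tsum_fintype, Finset.mul_sum, ← Finset.sum_coe_sort (Finset.Nat.antidiagonalTuple l.length k)]
  refine Finset.sum_congr rfl fun j _ => ?_
  simp only [Finset.Nat.sigmaAntidiagonalTupleEquivTuple_apply]
  rw [Finset.Nat.mem_antidiagonalTuple.1 j.2, ENNReal.tsum_mul_left, ENNReal.tsum_mul_left]
  rfl

/-! ### Multiple series over tuples as recursive nested sums -/

/-- The index set of the series of level `p`. -/
def levelIndex (p r : ℕ) : Set (Fin r → ℕ) :=
  {n | n ∈ zetaIndex r ∧ ∀ i : Fin r, n i ≡ r - (i : ℕ) [MOD p]}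

theorem levelIndex_one (r : ℕ) : levelIndex 1 r = zetaIndex r := by
  ext n
  simp [levelIndex, Nat.modEq_one]

theorem first_cons {r : ℕ} (N : ℕ) (n : Fin r → ℕ) :
    first (Fin.cons N n : Fin (r + 1) → ℕ) = N := by
  simp only [first, Nat.succ_pos, dif_pos]
  rfl

theorem monomial_cons (a : ℕ) (l : List ℕ) (N : ℕ) (n : Fin l.length → ℕ) :
    monomial (a :: l) (Fin.cons N n : Fin (l.length + 1) → ℕ) = (N : ℝ) ^ a * monomial l n :=
  Fin.prod_univ_succ (fun i : Fin (l.length + 1) =>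
    (((Fin.cons N n : Fin (l.length + 1) → ℕ) i : ℕ) : ℝ) ^ (a :: l).get i)

theorem cons_mem_zetaIndex {r : ℕ} (N : ℕ) (n : Fin r → ℕ) :
    (Fin.cons N n : Fin (r + 1) → ℕ) ∈ zetaIndex (r + 1) ↔ n ∈ zetaIndex r ∧ first n < N := by
  rcases r with _ | r
  · simp [zetaIndex, first, Fin.forall_fin_one, Subsingleton.strictAnti]
  · have h : StrictAnti (Fin.cons N n : Fin (r + 1 + 1) → ℕ) ↔ n 0 < N ∧ StrictAnti n :=
      strictAnti_vecCons
    have h' : first n = n 0 := rfl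
    simp only [zetaIndex, mem_ofPred_eq, h, h', Fin.forall_fin_succ (n := r + 1), Fin.cons_zero,
      Fin.cons_succ]
    constructor
    · rintro ⟨⟨h1, h2⟩, h3, h4⟩
      exact ⟨⟨h2, h4⟩, h1⟩
    · rintro ⟨⟨h2, h4⟩, h1⟩
      exact ⟨⟨h1, h2⟩, by omega, h4⟩

theorem first_modEq {p r : ℕ} {n : Fin r → ℕ} (hn : n ∈ levelIndex p r) : first n ≡ r [MOD p] := by
  rcases r with _ | r
  · exact Nat.ModEq.refl 0
  · exact hn.2 0

/-- Congruences to fixed residues are equivalent to a relation between neighbours, because the first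
entry of a depth r tuple is congruent to r. This also covers the empty tuple, whose first entry is 0
by convention. -/
theorem cons_mem_levelIndex {p r : ℕ} (N : ℕ) (n : Fin r → ℕ) :
    (Fin.cons N n : Fin (r + 1) → ℕ) ∈ levelIndex p (r + 1) ↔
      n ∈ levelIndex p r ∧ first n < N ∧ N ≡ first n + 1 [MOD p] := by
  have h : (Fin.cons N n : Fin (r + 1) → ℕ) ∈ levelIndex p (r + 1) ↔
      (n ∈ zetaIndex r ∧ first n < N) ∧ N ≡ r + 1 [MOD p] ∧ ∀ i : Fin r, n i ≡ r - i [MOD p] := by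
    simp only [levelIndex, mem_ofPred_eq, cons_mem_zetaIndex, Fin.forall_fin_succ (n := r),
      Fin.cons_zero, Fin.cons_succ, Fin.val_zero, Nat.sub_zero, Fin.val_succ, Nat.add_sub_add_right]
  rw [h]
  constructor
  · rintro ⟨⟨h1, h2⟩, h3, h4⟩
    exact ⟨⟨h1, h4⟩, h2, h3.trans ((first_modEq (p := p) ⟨h1, h4⟩).symm.add_right 1)⟩
  · rintro ⟨h1, h2, h3⟩
    exact ⟨⟨h1.1, h2⟩, h3.trans ((first_modEq h1).add_right 1), h1.2⟩

theorem monomial_nonneg (l : List ℕ) (n : Fin l.length → ℕ) : 0 ≤ monomial l n :=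
  Finset.prod_nonneg fun _ _ => by positivity

/-- The arbitrary weight `h` on the largest variable makes the induction close: for the tail it is
specialised to the condition linking that variable to the newly added one. -/
theorem tsum_indicator_levelIndex (p : ℕ) (l : List ℕ) (h : ℕ → ℝ≥0∞) :
    ∑' n : Fin l.length → ℕ, (levelIndex p l.length).indicator
      (fun n => (p : ℝ≥0∞) ^ l.length * ENNReal.ofReal (monomial l n)⁻¹ * h (first n)) n =
      ∑' N, coeff p 0 l N * h N := by
  induction l generalizing h with
  | nil =>
    refine (tsum_fin_zero _).trans ?_
    rw [tsum_eq_single 0 (fun N hN => by simp [coeff, hN])]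
    refine (indicator_of_mem ?_ _).trans ?_
    · exact ⟨⟨fun i => i.elim0, fun i => i.elim0⟩, fun i => i.elim0⟩
    · simp [coeff, first, monomial]
  | cons a l ih =>
    refine (tsum_fin_succ (r := l.length) _).trans ?_
    refine tsum_congr fun N => ?_
    rw [coeff]
    have e : ∑' m, step p m N * coeff p 0 l m = ∑' m, coeff p 0 l m * step p m N :=
      tsum_congr fun m => mul_comm _ _
    rw [e, ← ih fun m => step p m N, ← ENNReal.tsum_mul_left, ← ENNReal.tsum_mul_right]
    refine tsum_congr fun n => ?_
    have key := cons_mem_levelIndex (p := p) N n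
    by_cases hn : n ∈ levelIndex p l.length
    · by_cases hs : first n < N ∧ N ≡ first n + 1 [MOD p]
      · have hm := key.2 ⟨hn, hs⟩
        have hm' : (Fin.cons N n : Fin (a :: l).length → ℕ) ∈ levelIndex p (a :: l).length := hm
        rw [indicator_of_mem hm', indicator_of_mem hn, monomial_cons, first_cons, mul_inv,
          ENNReal.ofReal_mul (by positivity), sub_zero, ← inv_pow, ENNReal.ofReal_pow (by positivity),
          List.length_cons, pow_succ, step, if_pos hs]
        ring
      · have hm' : (Fin.cons N n : Fin (a :: l).length → ℕ) ∉ levelIndex p (a :: l).length :=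
          fun h => hs (key.1 h).2
        rw [indicator_of_notMem hm', indicator_of_mem hn, step, if_neg hs]
        simp
    · have hm' : (Fin.cons N n : Fin (a :: l).length → ℕ) ∉ levelIndex p (a :: l).length :=
          fun h => hn (key.1 h).1
      rw [indicator_of_notMem hm', indicator_of_notMem hn]
      simp

theorem tsum_levelIndex (p : ℕ) (l : List ℕ) {x : ℝ} (hx : 0 ≤ x) :
    ∑' n : levelIndex p l.length,
      ENNReal.ofReal ((p : ℝ) ^ l.length * (x ^ first n.1 / monomial l n)) =
      polySeries p 0 l x := by
  rw [tsum_subtype (levelIndex p l.length) fun n =>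
    ENNReal.ofReal ((p : ℝ) ^ l.length * (x ^ first n / monomial l n)), polySeries]
  simp only [sub_zero, Real.rpow_natCast]
  rw [← tsum_indicator_levelIndex p l fun N => ENNReal.ofReal (x ^ N)]
  refine tsum_congr fun n => ?_
  congr 1
  ext n
  have := monomial_nonneg l n
  rw [ENNReal.ofReal_mul (by positivity), div_eq_mul_inv, ENNReal.ofReal_mul (by positivity),
    ENNReal.ofReal_pow (by positivity), ENNReal.ofReal_natCast]
  ring

/-! ### Convergence of the series -/

theorem sum_range_inv_sqrt_le (n : ℕ) :
    ∑ N ∈ Finset.range (n + 1), (√(N : ℝ) / N) ≤ 2 * √(n : ℝ) := by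
  induction n with
  | zero => simp
  | succ n ih =>
    rw [Finset.sum_range_succ, Real.sqrt_div_self']
    refine (add_le_add_left ih _).trans ?_
    have h0 : 0 < √((n + 1 : ℕ) : ℝ) := Real.sqrt_pos.2 (by positivity)
    have h1 := Real.sq_sqrt (Nat.cast_nonneg (α := ℝ) (n + 1))
    have h2 := Real.sq_sqrt (Nat.cast_nonneg (α := ℝ) n)
    have h3 : 2 * √(n : ℝ) * √((n + 1 : ℕ) : ℝ) + 1 ≤ 2 * √((n + 1 : ℕ) : ℝ) * √((n + 1 : ℕ) : ℝ) := by
      push_cast at h1 ⊢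
      nlinarith [sq_nonneg (√(n : ℝ) - √((n : ℝ) + 1))]
    calc 2 * √(n : ℝ) + 1 / √((n + 1 : ℕ) : ℝ)
        = (2 * √(n : ℝ) * √((n + 1 : ℕ) : ℝ) + 1) / √((n + 1 : ℕ) : ℝ) := by field_simp
      _ ≤ 2 * √((n + 1 : ℕ) : ℝ) := (div_le_iff₀ h0).2 h3

theorem tsum_step_le (p N : ℕ) (f : ℕ → ℝ≥0∞) :
    ∑' m, step p m N * f m ≤ ∑ m ∈ Finset.range N, f m := by
  rw [tsum_eq_sum (s := Finset.range N)]
  · refine Finset.sum_le_sum fun m _ => ?_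
    unfold step
    split_ifs <;> simp
  · intro m hm
    have : ¬(m < N ∧ N ≡ m + 1 [MOD p]) := fun h => hm (Finset.mem_range.2 h.1)
    simp [step, this]

theorem coeff_cons_le (p : ℕ) {y : ℝ} (hy : y ≤ 1 / 2) (a : ℕ) (l : List ℕ)
    {K : ℝ}
    (hK : ∀ n : ℕ, ∑ m ∈ Finset.range n, coeff p y l m ≤ ENNReal.ofReal (K * √(n : ℝ))) (N : ℕ) :
    coeff p y (a :: l) N ≤ ENNReal.ofReal (p * 2 ^ a * K * (√(N : ℝ) / (N : ℝ) ^ a)) := by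
  rcases Nat.eq_zero_or_pos N with rfl | hN
  · simp [coeff_cons_zero]
  have hN1 : (1 : ℝ) ≤ N := by exact_mod_cast hN
  have h1 : ((N : ℝ) - y)⁻¹ ≤ 2 / N := by
    rw [inv_le_comm₀ (by linarith) (by positivity), inv_div]
    linarith
  calc coeff p y (a :: l) N
      ≤ p * ENNReal.ofReal (2 / N) ^ a * ENNReal.ofReal (K * √(N : ℝ)) := by
        rw [coeff]
        gcongr
        exact (tsum_step_le p N _).trans (hK N)
    _ = _ := by
        rw [← ENNReal.ofReal_pow (by positivity), ← ENNReal.ofReal_natCast,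
          ← ENNReal.ofReal_mul (by positivity), ← ENNReal.ofReal_mul (by positivity)]
        congr 1
        rw [div_pow]
        ring

/-- The true growth is at most a power of a logarithm, but a bound by √n reproduces itself under
summation against 1/N and is enough for convergence. -/
theorem exists_sum_coeff_le (p : ℕ) {y : ℝ} (hy : y ≤ 1 / 2) (l : List ℕ) (hl : ∀ a ∈ l, 0 < a) :
    ∃ K : ℝ, 0 ≤ K ∧
      ∀ n : ℕ, ∑ m ∈ Finset.range n, coeff p y l m ≤ ENNReal.ofReal (K * √(n : ℝ)) := by
  induction l with
  | nil =>
    refine ⟨1, zero_le_one, fun n => ?_⟩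
    rcases n with _ | n
    · simp
    · rw [Finset.sum_eq_single 0 (fun m _ hm => by simp [coeff, hm]) (by simp)]
      simp [coeff]
  | cons a l ih =>
    obtain ⟨K, hK0, hK⟩ := ih fun b hb => hl b (by simp [hb])
    refine ⟨p * 2 ^ a * K * 2, by positivity, fun n => ?_⟩
    rcases n with _ | n
    · simp
    calc ∑ m ∈ Finset.range (n + 1), coeff p y (a :: l) m
        ≤ ∑ m ∈ Finset.range (n + 1), ENNReal.ofReal (p * 2 ^ a * K * (√(m : ℝ) / m)) := by
          refine Finset.sum_le_sum fun m _ => (coeff_cons_le p hy a l hK m).trans ?_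
          rcases Nat.eq_zero_or_pos m with rfl | hm
          · simp
          have : (1 : ℝ) ≤ m := by exact_mod_cast hm
          gcongr
          exact le_self_pow₀ this (hl a (by simp)).ne'
      _ = ENNReal.ofReal (p * 2 ^ a * K * ∑ m ∈ Finset.range (n + 1), (√(m : ℝ) / m)) := by
          rw [Finset.mul_sum, ENNReal.ofReal_sum_of_nonneg fun m _ => by positivity]
      _ ≤ ENNReal.ofReal (p * 2 ^ a * K * 2 * √((n + 1 : ℕ) : ℝ)) := by
          rw [mul_assoc (_ * _) 2]
          gcongr
          refine (sum_range_inv_sqrt_le n).trans ?_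
          gcongr
          simp

theorem polySeries_one_ne_top (p : ℕ) {y : ℝ} (hy : y ≤ 1 / 2) {a : ℕ} (ha : 2 ≤ a) {l : List ℕ}
    (hl : ∀ a ∈ l, 0 < a) : polySeries p y (a :: l) 1 ≠ ∞ := by
  obtain ⟨K, hK0, hK⟩ := exists_sum_coeff_le p hy l hl
  rw [polySeries_one]
  -- The exponent is 1/2 - 2: the √N of the inner sums against a leading entry at least 2.
  have hs : Summable fun N : ℕ => p * 2 ^ a * K * (N : ℝ) ^ (-(3 / 2) : ℝ) :=
    (Real.summable_nat_rpow.2 (by norm_num)).mul_left _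
  refine ne_top_of_le_ne_top hs.tsum_ofReal_ne_top (ENNReal.tsum_le_tsum fun N => ?_)
  refine (coeff_cons_le p hy a l hK N).trans ?_
  rcases Nat.eq_zero_or_pos N with rfl | hN
  · simp
  have hN1 : (1 : ℝ) ≤ N := by exact_mod_cast hN
  gcongr
  calc √(N : ℝ) / (N : ℝ) ^ a ≤ √(N : ℝ) / (N : ℝ) ^ 2 := by gcongr
    _ = (N : ℝ) ^ (-(3 / 2) : ℝ) := by
      rw [Real.sqrt_eq_rpow, ← Real.rpow_natCast, ← Real.rpow_sub (by linarith)]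
      norm_num

theorem polySeries_zero_ne_top (p : ℕ) {l : List ℕ} (hl : ∀ a ∈ l, 0 < a) {x : ℝ}
    (hx : x ∈ Ioo (0 : ℝ) 1) (hne : l ≠ []) : polySeries p 0 l x ≠ ∞ := by
  -- Since N x^N is bounded, x^N ≤ M/N; the extra 1/N raises the leading entry to at least 2, which
  -- reduces the claim to convergence at 1.
  obtain ⟨M, hM⟩ := (tendsto_self_mul_const_pow_of_lt_one hx.1.le hx.2).bddAbove_range
  obtain ⟨a, l, rfl⟩ := List.exists_cons_of_ne_nil hne
  have ha := hl a (by simp)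
  have hfin := polySeries_one_ne_top p (y := 0) (by norm_num) (a := a + 1) (by omega)
    (l := l) fun b hb => hl b (by simp [hb])
  rw [polySeries_one] at hfin
  refine ne_top_of_le_ne_top (ENNReal.mul_ne_top (ENNReal.ofReal_ne_top (r := M)) hfin) ?_
  rw [← ENNReal.tsum_mul_left, polySeries]
  refine ENNReal.tsum_le_tsum fun N => ?_
  rcases Nat.eq_zero_or_pos N with rfl | hN
  · simp [coeff_cons_zero]
  have hN1 : (1 : ℝ) ≤ N := by exact_mod_cast hN
  have h1 : x ^ ((N : ℝ) - 0) ≤ M * ((N : ℝ) - 0)⁻¹ := by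
    rw [sub_zero, Real.rpow_natCast, ← div_eq_mul_inv, le_div_iff₀ (by linarith), mul_comm]
    exact hM ⟨N, rfl⟩
  have h2 := coeff_plus p 0 (l := a :: l) (by simp) N
  rw [plus] at h2
  have hM0 : 0 ≤ M := le_trans (by simp) (hM ⟨0, rfl⟩)
  calc coeff p 0 (a :: l) N * ENNReal.ofReal (x ^ ((N : ℝ) - 0))
      ≤ coeff p 0 (a :: l) N * ENNReal.ofReal (M * ((N : ℝ) - 0)⁻¹) := by gcongr
    _ = _ := by
      rw [h2, ENNReal.ofReal_mul hM0]
      ring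

/-! ### Comparison of coefficients of power series over [0, ∞] -/

theorem zero_le_of_tsum_pow_mul_eq {F G : ℕ → ℝ≥0∞}
    (h : ∀ y : ℝ, 0 < y → y < 1 →
      ∑' k, ENNReal.ofReal y ^ k * F k = ∑' k, ENNReal.ofReal y ^ k * G k)
    (hG : ∑' k, ENNReal.ofReal (1 / 2) ^ k * G (k + 1) ≠ ∞) : F 0 ≤ G 0 := by
  set R := ∑' k, ENNReal.ofReal (1 / 2) ^ k * G (k + 1) with hR
  -- For y < 1/2 the right-hand series is at most G 0 + yR with R finite, and it dominates F 0; then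
  -- y tends to 0.
  have ht : Tendsto (fun y : ℝ => G 0 + ENNReal.ofReal y * R) (𝓝[>] 0) (𝓝 (G 0)) := by
    have h1 : Tendsto (fun y : ℝ => ENNReal.ofReal y) (𝓝[>] 0) (𝓝 0) := by
      have := (ENNReal.continuous_ofReal.tendsto 0).mono_left (nhdsWithin_le_nhds (s := Ioi 0))
      rwa [ENNReal.ofReal_zero] at this
    have h2 := (ENNReal.Tendsto.mul_const (b := R) h1 (Or.inr hG)).const_add (G 0)
    simpa using h2
  refine ge_of_tendsto ht ?_
  filter_upwards [Ioo_mem_nhdsGT (show (0 : ℝ) < 1 / 2 by norm_num)] with y hy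
  calc F 0 ≤ ∑' k, ENNReal.ofReal y ^ k * F k := by
        simpa using ENNReal.le_tsum (f := fun k => ENNReal.ofReal y ^ k * F k) 0
    _ = ∑' k, ENNReal.ofReal y ^ k * G k := h y hy.1 (by linarith [hy.2])
    _ = G 0 + ENNReal.ofReal y * ∑' k, ENNReal.ofReal y ^ k * G (k + 1) := by
        rw [tsum_eq_zero_add' ENNReal.summable, ← ENNReal.tsum_mul_left]
        simp [pow_succ', mul_assoc]
    _ ≤ G 0 + ENNReal.ofReal y * R := by
        rw [hR]
        gcongr with k
        exact hy.2.le

theorem eq_of_tsum_pow_mul_eq {F G : ℕ → ℝ≥0∞}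
    (h : ∀ y : ℝ, 0 < y → y < 1 →
      ∑' k, ENNReal.ofReal y ^ k * F k = ∑' k, ENNReal.ofReal y ^ k * G k)
    (hG : ∑' k, ENNReal.ofReal (1 / 2) ^ k * G k ≠ ∞) (n : ℕ) : F n = G n := by
  have split : ∀ (y : ℝ) (H : ℕ → ℝ≥0∞), ∑' k, ENNReal.ofReal y ^ k * H k =
      H 0 + ENNReal.ofReal y * ∑' k, ENNReal.ofReal y ^ k * H (k + 1) := fun y H => by
    rw [tsum_eq_zero_add' ENNReal.summable, ← ENNReal.tsum_mul_left]
    simp [pow_succ', mul_assoc]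
  have tail : ∀ H : ℕ → ℝ≥0∞, ∑' k, ENNReal.ofReal (1 / 2) ^ k * H k ≠ ∞ →
      H 0 ≠ ∞ ∧ ∑' k, ENNReal.ofReal (1 / 2) ^ k * H (k + 1) ≠ ∞ := fun H hH => by
    rw [split, ENNReal.add_ne_top] at hH
    refine ⟨hH.1, fun h0 => hH.2 ?_⟩
    rw [h0, ENNReal.mul_top (by simp)]
  induction n generalizing F G with
  | zero =>
    have hF : ∑' k, ENNReal.ofReal (1 / 2) ^ k * F k ≠ ∞ := by
      rwa [h (1 / 2) (by norm_num) (by norm_num)]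
    exact le_antisymm (zero_le_of_tsum_pow_mul_eq h (tail G hG).2)
      (zero_le_of_tsum_pow_mul_eq (fun y h0 h1 => (h y h0 h1).symm) (tail F hF).2)
  | succ n ih =>
    have hF : ∑' k, ENNReal.ofReal (1 / 2) ^ k * F k ≠ ∞ := by
      rwa [h (1 / 2) (by norm_num) (by norm_num)]
    have h00 : F 0 = G 0 := le_antisymm (zero_le_of_tsum_pow_mul_eq h (tail G hG).2)
      (zero_le_of_tsum_pow_mul_eq (fun y h0 h1 => (h y h0 h1).symm) (tail F hF).2)
    -- The equal, finite constant terms are cancelled and y > 0 is divided out, which shifts both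
    -- sequences.
    refine ih (F := fun k => F (k + 1)) (G := fun k => G (k + 1)) (fun y h0 h1 => ?_) (tail G hG).2
    have h2 := h y h0 h1
    rw [split y F, split y G, h00, ENNReal.add_right_inj (tail G hG).1,
      ENNReal.mul_right_inj (by simpa using h0) ENNReal.ofReal_ne_top] at h2
    exact h2

/-! ### Moments and their generating function -/

/-- The integrand of `k! ξ(k + 1; l)` (for `p = 1`) and of `k! ψ(k + 1; l)` (for `p = 2`). -/
def momentIntegrand (p : ℕ) (l : List ℕ) (k : ℕ) (t : ℝ) : ℝ≥0∞ :=
  ENNReal.ofReal (t ^ k) * (ENNReal.ofReal (Real.exp (-t)) * form p true (Real.exp (-t)) *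
    polySeries p 0 l (invol p (Real.exp (-t))))

theorem measurable_momentIntegrand (p : ℕ) (l : List ℕ) (k : ℕ) :
    Measurable (momentIntegrand p l k) := by
  have he : Measurable fun t : ℝ => Real.exp (-t) := by fun_prop
  exact (by fun_prop : Measurable fun t : ℝ => ENNReal.ofReal (t ^ k)).mul
    ((he.ennreal_ofReal.mul ((measurable_form p true).comp he)).mul
      ((measurable_polySeries p 0 l).comp ((measurable_invol p).comp he)))

theorem exp_neg_mem {t : ℝ} (ht : 0 < t) : Real.exp (-t) ∈ Ioo (0 : ℝ) 1 :=
  ⟨Real.exp_pos _, Real.exp_lt_one_iff.2 (by linarith)⟩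

theorem image_exp_neg : (fun t : ℝ => Real.exp (-t)) '' Ioi 0 = Ioo 0 1 := by
  ext u
  constructor
  · rintro ⟨t, ht, rfl⟩
    exact exp_neg_mem ht
  · intro hu
    exact ⟨-Real.log u, neg_pos.2 (Real.log_neg hu.1 hu.2), by simp [Real.exp_log hu.1]⟩

theorem ofReal_exp_mul {y t : ℝ} (hy : 0 ≤ y) (ht : 0 ≤ t) :
    ENNReal.ofReal (Real.exp (y * t)) =
      ∑' k : ℕ, ENNReal.ofReal y ^ k * (ENNReal.ofReal (1 / (k.factorial : ℝ)) *
        ENNReal.ofReal (t ^ k)) := by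
  have h : HasSum (fun k : ℕ => (y * t) ^ k / (k.factorial : ℝ)) (Real.exp (y * t)) := by
    rw [Real.exp_eq_exp_ℝ]
    exact NormedSpace.expSeries_div_hasSum_exp (y * t)
  rw [← h.tsum_eq, ENNReal.ofReal_tsum_of_nonneg (fun k => by positivity) h.summable]
  refine tsum_congr fun k => ?_
  rw [← ENNReal.ofReal_pow hy, ← ENNReal.ofReal_mul (by positivity),
    ← ENNReal.ofReal_mul (by positivity)]
  congr 1
  rw [mul_pow]
  ring

/-- Under u = exp(-t) the factor u^(-y), which is the deformed polylogarithm of the empty index,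
becomes exp(yt); its exponential series yields the moments. -/
theorem tsum_moment (p : ℕ) {y : ℝ} (hy : 0 ≤ y) (l : List ℕ) :
    ∑' k : ℕ, ENNReal.ofReal y ^ k * (ENNReal.ofReal (1 / (k.factorial : ℝ)) *
      ∫⁻ t in Ioi 0, momentIntegrand p l k t) = pairing p y true l [] := by
  have hd : ∀ t ∈ Ioi (0 : ℝ), HasDerivWithinAt (fun t : ℝ => Real.exp (-t))
      (Real.exp (-t) * -1) (Ioi 0) t := fun t _ =>
    ((Real.hasDerivAt_exp (-t)).comp t (hasDerivAt_neg t)).hasDerivWithinAt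
  have hinj : InjOn (fun t : ℝ => Real.exp (-t)) (Ioi 0) := fun t _ s _ h =>
    neg_injective (Real.exp_injective h)
  rw [pairing, ← image_exp_neg,
    lintegral_image_eq_lintegral_abs_deriv_mul measurableSet_Ioi hd hinj]
  have hm := measurable_momentIntegrand p l
  simp only [← lintegral_const_mul _ (hm _), ← lintegral_const_mul _ ((hm _).const_mul _)]
  rw [← lintegral_tsum fun k => (((hm k).const_mul _).const_mul _).aemeasurable]
  refine setLIntegral_congr_fun measurableSet_Ioi fun t ht => ?_
  have h1 : polySeries p y [] (Real.exp (-t)) = ENNReal.ofReal (Real.exp (y * t)) := by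
    rw [polySeries, tsum_eq_single 0 (fun N hN => by simp [coeff, hN]), coeff, if_pos rfl, one_mul,
      ← Real.exp_mul]
    congr 2
    push_cast
    ring
  have h2 : |Real.exp (-t) * -1| = Real.exp (-t) := by simp
  simp only [h1, h2, ofReal_exp_mul hy (le_of_lt ht), momentIntegrand]
  rw [← ENNReal.tsum_mul_left, ← ENNReal.tsum_mul_right, ← ENNReal.tsum_mul_left]
  refine tsum_congr fun k => ?_
  ring

/-! ### Depth and admissibility of the dual index -/

theorem length_plus {l : List ℕ} (hl : l ≠ []) : (plus l).length = l.length := by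
  obtain ⟨a, l, rfl⟩ := List.exists_cons_of_ne_nil hl
  rfl

theorem hoffmanDual_ne_nil {l : List ℕ} (hl : l ≠ []) : hoffmanDual l ≠ [] := by
  obtain ⟨a, l, rfl⟩ := List.exists_cons_of_ne_nil hl
  simp [hoffmanDual, plus_ne_nil]

theorem length_hoffmanDual {l : List ℕ} (hne : l ≠ []) (hl : ∀ a ∈ l, 0 < a) :
    (hoffmanDual l).length + l.length = l.sum + 1 := by
  induction l with
  | nil => exact absurd rfl hne
  | cons a l ih =>
    have ha := hl a (by simp)
    rcases eq_or_ne l [] with rfl | h0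
    · simp [hoffmanDual, plus]
      omega
    · have := ih h0 fun b hb => hl b (by simp [hb])
      rw [hoffmanDual, List.length_append, length_plus (hoffmanDual_ne_nil h0),
        List.length_replicate, List.length_cons, List.sum_cons]
      omega

theorem reverse_pos {l : List ℕ} (hl : ∀ a ∈ l, 0 < a) : ∀ a ∈ l.reverse, 0 < a :=
  fun a ha => hl a (List.mem_reverse.1 ha)

theorem length_dualPlus {l : List ℕ} (h : IsComposition l) :
    (dualPlus l).length = l.sum + 1 - l.length := by
  have hr : l.reverse ≠ [] := by simpa using h.1
  have := length_hoffmanDual hr (reverse_pos h.2)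
  rw [List.length_reverse, List.sum_reverse] at this
  rw [dualPlus, length_plus (hoffmanDual_ne_nil hr)]
  omega

theorem exists_dualPlus_eq_cons {l : List ℕ} (h : IsComposition l) :
    ∃ a c, dualPlus l = a :: c ∧ 2 ≤ a ∧ ∀ b ∈ c, 0 < b := by
  have hr : l.reverse ≠ [] := by simpa using h.1
  obtain ⟨a, c, hac⟩ := List.exists_cons_of_ne_nil (hoffmanDual_ne_nil hr)
  have hpos := (hoffmanDual_aux l.reverse (reverse_pos h.2)).1
  rw [hac] at hpos
  have := hpos a (by simp)
  exact ⟨a + 1, c, by rw [dualPlus, hac, plus], by omega, fun b hb => hpos b (by simp [hb])⟩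

theorem add_pos_of_pos {l : List ℕ} (hl : ∀ a ∈ l, 0 < a) (j : List ℕ) : ∀ a ∈ add l j, 0 < a := by
  induction l generalizing j with
  | nil => simp [add]
  | cons b l ih =>
    rcases j with _ | ⟨i, j⟩
    · simp [add]
    · rw [add_cons]
      intro a ha
      rcases List.mem_cons.1 ha with rfl | ha
      · have := hl b (by simp)
        omega
      · exact ih (fun c hc => hl c (by simp [hc])) j a ha

theorem polySeries_add_dualPlus_ne_top (p : ℕ) {l : List ℕ} (h : IsComposition l)
    (j : Fin (dualPlus l).length → ℕ) :
    polySeries p 0 (add (dualPlus l) (List.ofFn j)) 1 ≠ ∞ := by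
  obtain ⟨a, c, hac, ha, hc⟩ := exists_dualPlus_eq_cons h
  revert j
  rw [hac]
  intro j
  rw [List.ofFn_succ, add_cons]
  exact polySeries_one_ne_top p (by norm_num) (by omega) (add_pos_of_pos hc _)

/-! ### The moment formula and its passage to complex integrals -/

theorem moment_eq {p : ℕ} (hp : p = 1 ∨ p = 2) {l : List ℕ} (h : IsComposition l) (k : ℕ) :
    ENNReal.ofReal (1 / (k.factorial : ℝ)) * ∫⁻ t in Ioi 0, momentIntegrand p l k t =
      ∑ j ∈ Finset.Nat.antidiagonalTuple (dualPlus l).length k,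
        (B (dualPlus l) (List.ofFn j) : ℝ≥0∞) *
          polySeries p 0 (add (dualPlus l) (List.ofFn j)) 1 := by
  obtain ⟨a, c, hac, ha, hc⟩ := exists_dualPlus_eq_cons h
  have hpos : ∀ b ∈ dualPlus l, 0 < b := by
    rw [hac]
    intro b hb
    rcases List.mem_cons.1 hb with rfl | hb
    · omega
    · exact hc b hb
  refine eq_of_tsum_pow_mul_eq
    (F := fun k => ENNReal.ofReal (1 / (k.factorial : ℝ)) * ∫⁻ t in Ioi 0, momentIntegrand p l k t)
    (G := fun k => ∑ j ∈ Finset.Nat.antidiagonalTuple (dualPlus l).length k,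
        (B (dualPlus l) (List.ofFn j) : ℝ≥0∞) *
          polySeries p 0 (add (dualPlus l) (List.ofFn j)) 1) (fun y hy0 hy1 => ?_) ?_ k
  · rw [tsum_moment p hy0.le l, pairing_eq_dualPlus hp hy1 l h.2,
      polySeries_one_eq_tsum p hy0.le hy1 _ hpos]
  -- At y = 1/2 the expansion sums back to the deformed series, which is finite because the leading
  -- entry is at least 2.
  · rw [← polySeries_one_eq_tsum p (by norm_num) (by norm_num) _ hpos, hac]
    exact polySeries_one_ne_top p le_rfl ha hc

/-- Read off from the moment formula, whose other side is a finite sum of convergent series; the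
integrand itself is never estimated. -/
theorem lintegral_momentIntegrand_ne_top {p : ℕ} (hp : p = 1 ∨ p = 2) {l : List ℕ}
    (h : IsComposition l) (k : ℕ) : ∫⁻ t in Ioi 0, momentIntegrand p l k t ≠ ∞ := by
  intro h0
  have h1 := moment_eq hp h k
  rw [h0, ENNReal.mul_top (by simp [Nat.factorial_pos])] at h1
  refine ENNReal.sum_ne_top.2 (fun j _ => ?_) h1.symm
  exact ENNReal.mul_ne_top (ENNReal.natCast_ne_top _) (polySeries_add_dualPlus_ne_top p h j)

theorem integrable_and_integral_eq {p : ℕ} (hp : p = 1 ∨ p = 2) {l : List ℕ} (h : IsComposition l)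
    (k : ℕ) {f : ℝ → ℂ} (hf : ∀ t ∈ Ioi (0 : ℝ), f t = ((momentIntegrand p l k t).toReal : ℂ)) :
    IntegrableOn f (Ioi 0) ∧ 1 / Complex.Gamma ((k : ℂ) + 1) * ∫ t in Ioi (0 : ℝ), f t =
      ((∑ j ∈ Finset.Nat.antidiagonalTuple (dualPlus l).length k,
        (B (dualPlus l) (List.ofFn j) : ℝ) *
          (polySeries p 0 (add (dualPlus l) (List.ofFn j)) 1).toReal : ℝ) : ℂ) := by
  have hm := measurable_momentIntegrand p l k
  have hfin := lintegral_momentIntegrand_ne_top hp h k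
  have hint : IntegrableOn (fun t => (momentIntegrand p l k t).toReal) (Ioi 0) :=
    integrable_toReal_of_lintegral_ne_top hm.aemeasurable hfin
  refine ⟨(IntegrableOn.congr_fun (f := fun t => ((momentIntegrand p l k t).toReal : ℂ))
    hint.ofReal (fun t ht => (hf t ht).symm) measurableSet_Ioi), ?_⟩
  rw [setIntegral_congr_fun measurableSet_Ioi hf, integral_complex_ofReal,
    integral_toReal hm.aemeasurable (ae_lt_top hm hfin), Complex.Gamma_nat_eq_factorial]
  have h1 := congrArg ENNReal.toReal (moment_eq hp h k)
  rw [ENNReal.toReal_mul, ENNReal.toReal_ofReal (by positivity), ENNReal.toReal_sum fun j _ =>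
    ENNReal.mul_ne_top (ENNReal.natCast_ne_top _) (polySeries_add_dualPlus_ne_top p h j)] at h1
  simp only [ENNReal.toReal_mul, ENNReal.toReal_natCast] at h1
  rw [← h1]
  push_cast
  rfl

/-! ### Identification with ζ, T, Li, A and the integrands of ξ and ψ -/

/-- The terms of the series of level `p`, of which `liTerm` and `aTerm` are instances. -/
def levelTerm (p : ℕ) (l : List ℕ) (x : ℝ) (n : levelIndex p l.length) : ℝ :=
  (p : ℝ) ^ l.length * (x ^ first n.1 / monomial l n)

theorem levelTerm_nonneg (p : ℕ) (l : List ℕ) {x : ℝ} (hx : 0 ≤ x) (n : levelIndex p l.length) :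
    0 ≤ levelTerm p l x n := by
  have := monomial_nonneg l n
  unfold levelTerm
  positivity

theorem tsum_levelTerm (p : ℕ) (l : List ℕ) {x : ℝ} (hx : 0 ≤ x) :
    ∑' n, levelTerm p l x n = (polySeries p 0 l x).toReal := by
  rw [← tsum_levelIndex p l hx, ENNReal.tsum_toReal_eq fun _ => ENNReal.ofReal_ne_top]
  exact tsum_congr fun n => (ENNReal.toReal_ofReal (levelTerm_nonneg p l hx n)).symm

theorem summable_levelTerm (p : ℕ) (l : List ℕ) {x : ℝ} (hx : 0 ≤ x)
    (h : polySeries p 0 l x ≠ ∞) : Summable (levelTerm p l x) := by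
  rw [← tsum_levelIndex p l hx] at h
  refine (ENNReal.summable_toReal h).congr fun n => ?_
  exact ENNReal.toReal_ofReal (levelTerm_nonneg p l hx n)

theorem summable_comp_levelIndex_one {l : List ℕ} {f : zetaIndex l.length → ℝ} {x : ℝ}
    (h : ∀ n : zetaIndex l.length, f n = levelTerm 1 l x ⟨n.1, by rw [levelIndex_one]; exact n.2⟩) :
    (Summable f ↔ Summable (levelTerm 1 l x)) ∧ ∑' n, f n = ∑' n, levelTerm 1 l x n := by
  let e : zetaIndex l.length ≃ levelIndex 1 l.length := Equiv.setCongr (levelIndex_one _).symm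
  have hf : f = levelTerm 1 l x ∘ e := funext h
  rw [hf]
  exact ⟨e.summable_iff, e.tsum_eq _⟩

theorem liTerm_eq (l : List ℕ) (x : ℝ) (n : zetaIndex l.length) :
    liTerm l x n = levelTerm 1 l x ⟨n.1, by rw [levelIndex_one]; exact n.2⟩ := by
  simp [liTerm, levelTerm]

theorem zetaTerm_eq (l : List ℕ) (n : zetaIndex l.length) :
    zetaTerm l n = levelTerm 1 l 1 ⟨n.1, by rw [levelIndex_one]; exact n.2⟩ := by
  simp [zetaTerm, levelTerm]

theorem aTerm_eq (l : List ℕ) (x : ℝ) : aTerm l x = levelTerm 2 l x := by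
  ext n
  simp [aTerm, levelTerm]

theorem tTerm_eq (l : List ℕ) : tTerm l = levelTerm 2 l 1 := by
  ext n
  simp [tTerm, levelTerm, div_eq_mul_inv]

theorem Li_eq (l : List ℕ) {x : ℝ} (hx : 0 ≤ x) : Li l x = (polySeries 1 0 l x).toReal := by
  rw [Li, (summable_comp_levelIndex_one (liTerm_eq l x)).2, tsum_levelTerm 1 l hx]

theorem zeta_eq (l : List ℕ) : zeta l = (polySeries 1 0 l 1).toReal := by
  rw [zeta, (summable_comp_levelIndex_one (zetaTerm_eq l)).2, tsum_levelTerm 1 l zero_le_one]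

theorem A_eq (l : List ℕ) {x : ℝ} (hx : 0 ≤ x) : A l x = (polySeries 2 0 l x).toReal := by
  rw [A, aTerm_eq]
  exact tsum_levelTerm 2 l hx

theorem tValue_eq (l : List ℕ) : tValue l = (polySeries 2 0 l 1).toReal := by
  rw [tValue, tTerm_eq]
  exact tsum_levelTerm 2 l zero_le_one

theorem toReal_momentIntegrand (p : ℕ) (l : List ℕ) (k : ℕ) {t : ℝ}
    (ht : 0 < t) :
    (momentIntegrand p l k t).toReal = t ^ k * (Real.exp (-t) * dens p (Real.exp (-t)) *
      (polySeries p 0 l (invol p (Real.exp (-t)))).toReal) := by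
  have he := exp_neg_mem ht
  have hpow : Real.exp (-t) ^ p ≤ 1 := pow_le_one₀ he.1.le he.2.le
  have hd : 0 ≤ dens p (Real.exp (-t)) := div_nonneg (Nat.cast_nonneg _) (by linarith)
  rw [momentIntegrand, ENNReal.toReal_mul, ENNReal.toReal_mul, ENNReal.toReal_mul, form, cond_true,
    ENNReal.toReal_ofReal (by positivity), ENNReal.toReal_ofReal (by positivity),
    ENNReal.toReal_ofReal hd]

theorem xiIntegrand_eq (l : List ℕ) (k : ℕ) {t : ℝ} (ht : 0 < t) :
    xiIntegrand ((k : ℂ) + 1) l t = ((momentIntegrand 1 l k t).toReal : ℂ) := by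
  have he := exp_neg_mem ht
  have h1 : invol 1 (Real.exp (-t)) = 1 - Real.exp (-t) := by simp [invol]
  -- The factor exp(-t) is the Jacobian of u = exp(-t).
  have h2 : Real.exp (-t) * dens 1 (Real.exp (-t)) = 1 / (Real.exp t - 1) := by
    have h3 : Real.exp t - 1 ≠ 0 := (sub_pos.2 (Real.one_lt_exp_iff.2 ht)).ne'
    have h4 : 1 - Real.exp (-t) ≠ 0 := (sub_pos.2 he.2).ne'
    have h5 : Real.exp (-t) * Real.exp t = 1 := by rw [← Real.exp_add]; simp
    rw [dens]
    field_simp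
    simp only [Nat.cast_one]
    field_simp
    linear_combination h5
  rw [toReal_momentIntegrand 1 l k ht, h1, h2, xiIntegrand,
    Li_eq l (by linarith [he.2] : 0 ≤ 1 - Real.exp (-t)), add_sub_cancel_right, Complex.cpow_natCast]
  push_cast
  ring

theorem psiIntegrand_eq (l : List ℕ) (k : ℕ) {t : ℝ} (ht : 0 < t) :
    psiIntegrand ((k : ℂ) + 1) l t = ((momentIntegrand 2 l k t).toReal : ℂ) := by
  have he := exp_neg_mem ht
  have h5 : Real.exp (-t) * Real.exp t = 1 := by rw [← Real.exp_add]; simp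
  have h1 : invol 2 (Real.exp (-t)) = Real.tanh (t / 2) := by
    have h6 : Real.exp (-t) = Real.exp (-(t / 2)) * Real.exp (-(t / 2)) := by
      rw [← Real.exp_add]; congr 1; ring
    have h7 : Real.exp (-(t / 2)) * Real.exp (t / 2) = 1 := by rw [← Real.exp_add]; simp
    have h8 := Real.exp_pos (-(t / 2))
    have h9 := Real.exp_pos (t / 2)
    rw [Real.tanh_eq_sinh_div_cosh, Real.sinh_eq, Real.cosh_eq, invol, h6]
    norm_num
    rw [div_eq_div_iff (by positivity) (by positivity)]
    linear_combination (-Real.exp (-(t / 2))) * h7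
  have h2 : Real.exp (-t) * dens 2 (Real.exp (-t)) = 1 / Real.sinh t := by
    have h3 : Real.sinh t ≠ 0 := (Real.sinh_pos_iff.2 ht).ne'
    have h4 : 1 - Real.exp (-t) ^ 2 ≠ 0 := (sub_pos.2 (pow_lt_one₀ he.1.le he.2 two_ne_zero)).ne'
    rw [dens, ← mul_div_assoc, div_eq_div_iff h4 h3, Real.sinh_eq]
    push_cast
    linear_combination h5
  have h0 : 0 ≤ Real.tanh (t / 2) := h1 ▸ (invol_mem (Or.inr rfl) he).1.le
  rw [toReal_momentIntegrand 2 l k ht, h1, h2, psiIntegrand, A_eq l h0,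
    add_sub_cancel_right, Complex.cpow_natCast]
  push_cast
  ring

end

end ArakawaKaneko

theorem mainTheorem2 (κ : List ℕ) (hκ : ArakawaKaneko.IsComposition κ) (k n : ℕ)
    (hn : n = κ.sum + 1 - κ.length) :
    -- the series and integrals involved converge absolutely
    ((∀ x ∈ Set.Ioo (0 : ℝ) 1, Summable (ArakawaKaneko.liTerm κ x)) ∧
      MeasureTheory.IntegrableOn (ArakawaKaneko.xiIntegrand ((k : ℂ) + 1) κ) (Set.Ioi 0) ∧
      ∀ j ∈ Finset.Nat.antidiagonalTuple n k,
        Summable (ArakawaKaneko.zetaTerm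
          (ArakawaKaneko.add (ArakawaKaneko.dualPlus κ) (List.ofFn j)))) ∧
    ((∀ x ∈ Set.Ioo (0 : ℝ) 1, Summable (ArakawaKaneko.aTerm κ x)) ∧
      MeasureTheory.IntegrableOn (ArakawaKaneko.psiIntegrand ((k : ℂ) + 1) κ) (Set.Ioi 0) ∧
      ∀ j ∈ Finset.Nat.antidiagonalTuple n k,
        Summable (ArakawaKaneko.tTerm
          (ArakawaKaneko.add (ArakawaKaneko.dualPlus κ) (List.ofFn j)))) ∧
    -- the two formulas
    ArakawaKaneko.xi ((k : ℂ) + 1) κ =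
      ((∑ j ∈ Finset.Nat.antidiagonalTuple n k,
        (ArakawaKaneko.B (ArakawaKaneko.dualPlus κ) (List.ofFn j) : ℝ) *
          ArakawaKaneko.zeta (ArakawaKaneko.add (ArakawaKaneko.dualPlus κ) (List.ofFn j)) : ℝ) : ℂ) ∧
    ArakawaKaneko.psi ((k : ℂ) + 1) κ =
      ((∑ j ∈ Finset.Nat.antidiagonalTuple n k,
        (ArakawaKaneko.B (ArakawaKaneko.dualPlus κ) (List.ofFn j) : ℝ) *
          ArakawaKaneko.tValue (ArakawaKaneko.add (ArakawaKaneko.dualPlus κ) (List.ofFn j)) : ℝ) : ℂ) := by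
  obtain rfl : n = (ArakawaKaneko.dualPlus κ).length := by
    rw [hn, ArakawaKaneko.length_dualPlus hκ]
  have hxi := ArakawaKaneko.integrable_and_integral_eq (Or.inl rfl) hκ k
    fun t ht => ArakawaKaneko.xiIntegrand_eq κ k ht
  have hpsi := ArakawaKaneko.integrable_and_integral_eq (Or.inr rfl) hκ k
    fun t ht => ArakawaKaneko.psiIntegrand_eq κ k ht
  refine ⟨⟨fun x hx => ?_, hxi.1, fun j _ => ?_⟩, ⟨fun x hx => ?_, hpsi.1, fun j _ => ?_⟩, ?_, ?_⟩
  · rw [(ArakawaKaneko.summable_comp_levelIndex_one (ArakawaKaneko.liTerm_eq κ x)).1]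
    exact ArakawaKaneko.summable_levelTerm 1 κ hx.1.le
      (ArakawaKaneko.polySeries_zero_ne_top 1 hκ.2 hx hκ.1)
  · rw [(ArakawaKaneko.summable_comp_levelIndex_one (ArakawaKaneko.zetaTerm_eq _)).1]
    exact ArakawaKaneko.summable_levelTerm 1 _ zero_le_one
      (ArakawaKaneko.polySeries_add_dualPlus_ne_top 1 hκ j)
  · rw [ArakawaKaneko.aTerm_eq]
    exact ArakawaKaneko.summable_levelTerm 2 κ hx.1.le
      (ArakawaKaneko.polySeries_zero_ne_top 2 hκ.2 hx hκ.1)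
  · rw [ArakawaKaneko.tTerm_eq]
    exact ArakawaKaneko.summable_levelTerm 2 _ zero_le_one
      (ArakawaKaneko.polySeries_add_dualPlus_ne_top 2 hκ j)
  · simp only [ArakawaKaneko.zeta_eq]
    exact hxi.2
  · simp only [ArakawaKaneko.tValue_eq]
    exact hpsi.2
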